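/- **Conventions.** Let $\lambda$ be an infinite regular cardinal and let $\mathcal C$ be a locally $\lambda$-presentable category. An object is $\lambda$-presentable if its covariant hom-functor preserves (small) $\lambda$-filtered colimits. A morphism $f\colon A\to B$ is $\lambda$-presentable if it is a $\lambda$-presentable object of the comma category $(A\downarrow\mathcal C)$. An object $K$ is injective with respect to (resp. orthogonal to) $n\colon A\to B$ if every $u\colon A\to K$ is of the form $wn$ for some (resp. a unique) $w\colon B\to K$. For a class $\mathcal N$ of morphisms, $\mathcal N^{\vartriangle}$ (resp. $\mathcal N^{\perp}$) is the class of objects injective with respect to (resp. orthogonal to) every $n\in\mathcal N$. For a class $\mathcal K$ of objects, $\mathcal K^{\triangledown}$ (resp. $\mathcal K^{\top}$) is the class of morphisms with respect to which (resp. to which) every $K\in\mathcal K$ is injective (resp. orthogonal). A class of objects is a $\lambda$-injectivity class (resp. $\lambda$-orthogonality class) if it equals $\mathcal N^{\vartriangle}$ (resp. $\mathcal N^{\perp}$) for some class $\mathcal N$ of morphisms with $\lambda$-presentable domains and codomains. Write $p\,\Box\,i$ (resp. $p\perp i$) if every commutative square $vp=iu$ has a (resp. a unique) diagonal $w$ with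 $wp=u$ and $iw=v$. Let $\mathcal N^{\Box}=\{i : p\,\Box\, i\ \forall p\in\mathcal N\}$ and ${}^{\Box}\mathcal N=\{p : p\,\Box\, i\ \forall i\in\mathcal N\}$; let $\mathcal N^{\downarrow}$ and $\mathcal N^{\uparrow}$ be defined in the same way from $\perp$. A weak factorization system (resp. factorization system) is a pair $(\mathcal E,\mathcal R)$ of classes of morphisms with ${}^{\Box}\mathcal R=\mathcal E$ and $\mathcal E^{\Box}=\mathcal R$ (resp. $\mathcal R^{\uparrow}=\mathcal E$ and $\mathcal E^{\downarrow}=\mathcal R$) such that every morphism factors as $me$ with $e\in\mathcal E$, $m\in\mathcal R$; it is functorial if such factorizations can be chosen functorially in the arrow category. It determines the class of objects $X$ whose morphism $X\to\mathbf 1$ to the terminal object lies in $\mathcal R$. $\mathrm{Po}(\mathcal N)$ is the class of pushouts of members of $\mathcal N$. $\mathrm{Cof}(\mathcal N)$ is the class of retracts, in the comma categories $(A\downarrow\mathcal C)$, of transfinite compositions of members of $\mathrm{Po}(\mathcal N)$. $\mathrm{Fc}_\lambda(\mathcal N)$ is the class of canonical morphisms $A\to\operatorname{colim}_j C_j$ for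 small $\lambda$-filtered diagrams $(A\to C_j)_j$ in $(A\downarrow\mathcal C)$ whose objects $A\to C_j$ are all in $\mathcal N$. **Proposition 1.6.** Let $\mathcal M$ be a class of $\lambda$-presentable morphisms of $\mathcal C$, and let $\mathcal K=\mathcal M^{\vartriangle}$. The following are equivalent: 1. $\mathcal K$ is a $\lambda$-injectivity class; 2. $\mathcal K$ is closed under $\lambda$-filtered colimits in $\mathcal C$; 3. every $m\in\mathcal M$ is a pushout of some morphism in $\mathcal K^{\triangledown}$ with $\lambda$-presentable domain and codomain; 4. there is a (small) set $\mathcal N$ of morphisms with $\lambda$-presentable domains and codomains such that $(\mathrm{Cof}(\mathcal N),\mathcal N^{\Box})$ is a functorial weak factorization system that determines $\mathcal K$. Likewise, for $\mathcal K=\mathcal M^{\perp}$ the following are equivalent: 1. $\mathcal K$ is a $\lambda$-orthogonality class; 2. $\mathcal K$ is closed under $\lambda$-filtered colimits in $\mathcal C$; 3. every $m\in\mathcal M$ is a pushout of some morphism in $\mathcal K^{\top}$ with $\lambda$-presentable domain and codomain; 4. there is a (small) set $\mathcal N$ of morphisms with $\lambda$-presentable domains and codomains such that $(\mathrm{Fc}_\lambda(\mathrm{Po}(\mathcal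 N)),\mathcal N^{\downarrow})$ is a factorization system that determines $\mathcal K$. -/

import Mathlib

open CategoryTheory Limits

universe w v u

namespace PresentableMorphisms

variable {C : Type u} [Category.{v} C]

/-! ### Presentability -/

/-- A morphism `f : A ⟶ B` is `κ`-presentable if it is a `κ`-presentable object of the
comma category `A ↓ C`. -/
def presentableMorphisms (C : Type u) [Category.{v} C] (κ : Cardinal.{w}) [Fact κ.IsRegular] :
    MorphismProperty C :=
  fun _ _ f => IsCardinalPresentable (Under.mk f) κ

/-- The class of morphisms whose domain and codomain are `κ`-presentable objects. -/
def betweenPresentables (C : Type u) [Category.{v} C] (κ : Cardinal.{w}) [Fact κ.IsRegular] :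
    MorphismProperty C :=
  fun A B _ => IsCardinalPresentable A κ ∧ IsCardinalPresentable B κ

/-! ### Injectivity and orthogonality -/

/-- `K` is injective with respect to `n : A ⟶ B`: every `A ⟶ K` extends along `n`. -/
def IsInjectiveTo {A B : C} (n : A ⟶ B) (K : C) : Prop :=
  ∀ x : A ⟶ K, ∃ y : B ⟶ K, n ≫ y = x

/-- `K` is orthogonal to `n : A ⟶ B`: every `A ⟶ K` extends uniquely along `n`. -/
def IsOrthogonalTo {A B : C} (n : A ⟶ B) (K : C) : Prop :=
  ∀ x : A ⟶ K, ∃! y : B ⟶ K, n ≫ y = x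

/-- The class of objects injective with respect to all members of `N`. -/
def injectiveObjects (N : MorphismProperty C) : ObjectProperty C :=
  fun K => ∀ ⦃A B : C⦄ (n : A ⟶ B), N n → IsInjectiveTo n K

/-- The class of objects orthogonal to all members of `N`. -/
def orthogonalObjects (N : MorphismProperty C) : ObjectProperty C :=
  fun K => ∀ ⦃A B : C⦄ (n : A ⟶ B), N n → IsOrthogonalTo n K

/-- The class of morphisms with respect to which all members of `P` are injective. -/
def injectiveMorphisms (P : ObjectProperty C) : MorphismProperty C :=
  fun _ _ n => ∀ K : C, P K → IsInjectiveTo n K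

/-- The class of morphisms to which all members of `P` are orthogonal. -/
def orthogonalMorphisms (P : ObjectProperty C) : MorphismProperty C :=
  fun _ _ n => ∀ K : C, P K → IsOrthogonalTo n K

/-- `P` is a `κ`-injectivity class: the class of objects injective with respect to some class
of morphisms with `κ`-presentable domains and codomains. -/
def IsInjectivityClass (κ : Cardinal.{w}) [Fact κ.IsRegular] (P : ObjectProperty C) : Prop :=
  ∃ N : MorphismProperty C, N ≤ betweenPresentables C κ ∧ P = injectiveObjects N

/-- `P` is a `κ`-orthogonality class: the class of objects orthogonal to some class
of morphisms with `κ`-presentable domains and codomains. -/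
def IsOrthogonalityClass (κ : Cardinal.{w}) [Fact κ.IsRegular] (P : ObjectProperty C) : Prop :=
  ∃ N : MorphismProperty C, N ≤ betweenPresentables C κ ∧ P = orthogonalObjects N

/-- `P` is closed under (small) `κ`-filtered colimits in `C`. -/
def ClosedUnderFilteredColimits (κ : Cardinal.{w}) [Fact κ.IsRegular]
    (P : ObjectProperty C) : Prop :=
  ∀ (J : Type w) [SmallCategory J] [IsCardinalFiltered J κ], P.IsClosedUnderColimitsOfShape J

/-! ### Factorization systems -/

/-- `p ⊥ i`: every commutative square from `p` to `i` has a unique diagonal. -/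
def UniqueLifting {A B X Y : C} (p : A ⟶ B) (i : X ⟶ Y) : Prop :=
  ∀ (f : A ⟶ X) (g : B ⟶ Y), f ≫ i = p ≫ g → ∃! d : B ⟶ X, p ≫ d = f ∧ d ≫ i = g

/-- The class of morphisms `i` with `p ⊥ i` for all `p` in `N`. -/
def rightOrthogonal (N : MorphismProperty C) : MorphismProperty C :=
  fun _ _ i => ∀ ⦃A B : C⦄ (p : A ⟶ B), N p → UniqueLifting p i

/-- The class of morphisms `p` with `p ⊥ i` for all `i` in `N`. -/
def leftOrthogonal (N : MorphismProperty C) : MorphismProperty C :=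
  fun _ _ p => ∀ ⦃X Y : C⦄ (i : X ⟶ Y), N i → UniqueLifting p i

/-- The pair `(E, R)` is an (orthogonal) factorization system. -/
structure IsFactorizationSystem (E R : MorphismProperty C) : Prop where
  left_eq : leftOrthogonal R = E
  right_eq : rightOrthogonal E = R
  hasFactorization : E.HasFactorization R

/-- `P` is the class determined by a (weak) factorization system with right class `R`:
it consists of the objects whose morphism to the terminal object lies in `R`. -/
def IsDeterminedBy (P : ObjectProperty C) (R : MorphismProperty C) : Prop :=
  ∃ (T : C) (hT : IsTerminal T), ∀ X : C, P X ↔ R (hT.from X)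

/-- The retracts, in the comma categories `A ↓ C`, of the members of `N`. -/
def underRetracts (N : MorphismProperty C) : MorphismProperty C :=
  fun A _ f => ∃ (B' : C) (g : A ⟶ B'), N g ∧ Nonempty (Retract (Under.mk f) (Under.mk g))

/-- The cofibrations of `N`: retracts of transfinite compositions (along `w`-small ordinals)
of pushouts of members of `N`. -/
def cofibrations (N : MorphismProperty C) : MorphismProperty C :=
  underRetracts (MorphismProperty.transfiniteCompositions.{w} N.pushouts)

/-- The canonical morphisms `A ⟶ colim D` for `D` a small `κ`-filtered diagram of members of
`N` with domain `A` in the comma category `A ↓ C`. -/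
def filteredColimits (κ : Cardinal.{w}) [Fact κ.IsRegular] (N : MorphismProperty C) :
    MorphismProperty C :=
  fun A B f => ∃ (J : Type w) (_ : SmallCategory J) (_ : IsCardinalFiltered J κ)
    (D : J ⥤ Under A) (c : Cocone (D ⋙ Under.forget A)) (_ : IsColimit c) (e : c.pt ≅ B),
    (∀ j, N (D.obj j).hom) ∧ ∀ j, (D.obj j).hom ≫ c.ι.app j ≫ e.hom = f

end PresentableMorphisms

open PresentableMorphisms

/-!
Write `𝒦` for the class of objects injective with respect (or orthogonal) to `M`.

*From closure under `κ`-filtered colimits to pushouts.* A `κ`-presentable morphism `m : A ⟶ B` is a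
pushout of some `n : A₀ ⟶ B₀` between `κ`-presentable objects (`presentableMorphisms_le_pushouts`).
Write `A` as a `κ`-filtered colimit of `κ`-presentable objects `D j`. Then `m` is a pushout of the
pushout `n j` of `n` along `A₀ ⟶ D j`, for all large `j`, and one has to find a `j` for which all
members of `𝒦` are injective with respect to `n j`. If each `n j` had a counterexample `K j` in `𝒦`,
then products of the `K j` would form a `κ`-filtered diagram whose colimit, which is in `𝒦`, is not
injective with respect to `m` (`exists_extension_of_isColimit`). Uniqueness of extensions is treated
in the same way, as an extension property for codiagonals (`pushouts_orthogonalMorphisms`).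
Conversely, injectivity and orthogonality pass from a morphism to its pushouts, and injectivity and
orthogonality with respect to morphisms between `κ`-presentable objects are stable under
`κ`-filtered colimits.

*Orthogonal factorizations.* Let `W` be the class of morphisms between `κ`-presentable objects that
are left orthogonal to a class `R`. The factorizations of a morphism `f` whose first part is a
pushout of a member of `W` form an essentially small `κ`-filtered category, and their colimit is a
factorization of `f` whose second part is right orthogonal to `W` (`exists_factorization`). For
`R = rightOrthogonal N₀` this is the factorization system generated by `N₀`. For `R` the class of
isomorphisms it exhibits an arbitrary morphism as a `κ`-filtered colimit of pushouts of morphisms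
between `κ`-presentable objects, which leads to `presentableMorphisms_le_pushouts`.

*Weak factorizations.* The small object argument yields transfinite compositions of pushouts of
coproducts. To obtain transfinite compositions of pushouts of single members of the generating set,
the cells are attached one at a time (`pushouts_coproducts_le_transfiniteCompositions`), and the
resulting compositions are concatenated along a lexicographic order
(`transfiniteCompositions_of_transfiniteCompositionOfShape`).
The generating set contains the representatives of all morphisms between `κ`-presentable objects
with respect to which the members of `𝒦` are injective; in particular its pushouts include the
isomorphisms.
-/

namespace PresentableMorphisms

/-! ### Limits in locally presentable categories -/

/-- A locally `κ`-presentable category is complete: the restricted Yoneda functor to presheaves on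
its `κ`-presentable objects is reflective. As Mathlib's adjunction wants the source category and its
morphisms in matching universes, `C` is replaced by `ShrinkHoms C`. -/
theorem hasLimitsOfSize_of_isCardinalLocallyPresentable {C : Type u} [Category.{v} C]
    (κ : Cardinal.{w}) [Fact κ.IsRegular] [IsCardinalLocallyPresentable C κ] :
    HasLimitsOfSize.{w, w} C := by
  have : LocallySmall.{w} C := inferInstance
  let e := ShrinkHoms.equivalence.{w} C
  have : HasColimitsOfSize.{w, w} (ShrinkHoms.{u} C) :=
    ⟨fun J _ => Adjunction.hasColimitsOfShape_of_equivalence e.inverse⟩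
  let A := (isCardinalPresentable C κ).FullSubcategory
  have : EssentiallySmall.{w} A := inferInstance
  let F : SmallModel.{w} A ⥤ ShrinkHoms.{u} C :=
    ((equivSmallModel.{w} A).inverse ⋙ (isCardinalPresentable C κ).ι) ⋙ e.functor
  have : F.IsDense := inferInstance
  let adj := Presheaf.uliftYonedaAdjunction.{w} _ (uliftYoneda.{w}.leftKanExtensionUnit F)
  let : Reflective (Presheaf.restrictedULiftYoneda.{w} F) := ⟨_, adj⟩
  have : HasLimitsOfSize.{w, w} (ShrinkHoms.{u} C) :=
    hasLimits_of_reflective (Presheaf.restrictedULiftYoneda.{w} F)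
  exact ⟨fun J _ => Adjunction.hasLimitsOfShape_of_equivalence e.functor⟩

/-! ### Pushouts over a filtered diagram -/

section PushoutDiagram

variable {C : Type u} [Category.{v} C] {J : Type w} [Category.{w} J]
  (D : J ⥤ C) {j₀ : J} {A B : C} (p : A ⟶ D.obj j₀) (n : A ⟶ B)

/-- The diagram of the pushouts of `n : A ⟶ B` along the morphisms `A ⟶ D.obj j₀ ⟶ D.obj j`,
indexed by the morphisms `j₀ ⟶ j`. The diagram is indexed by `Under j₀` as `A ⟶ D.obj j₀` need
not have a canonical composite to a given `D.obj j`. -/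
structure PushoutDiagram where
  /-- the diagram of the pushouts -/
  G : Under j₀ ⥤ C
  /-- the morphisms opposite to `n` -/
  inl (j : Under j₀) : D.obj j.right ⟶ G.obj j
  /-- the morphisms opposite to `A ⟶ D.obj j` -/
  inr (j : Under j₀) : B ⟶ G.obj j
  inl_map {j k : Under j₀} (φ : j ⟶ k) : inl j ≫ G.map φ = D.map φ.right ≫ inl k
  inr_map {j k : Under j₀} (φ : j ⟶ k) : inr j ≫ G.map φ = inr k
  isPushout (j : Under j₀) : IsPushout (p ≫ D.map j.hom) n (inl j) (inr j)

attribute [local simp] pushout.inl_desc pushout.inl_desc_assoc pushout.inr_desc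
  pushout.inr_desc_assoc in
/-- The diagram of the chosen pushouts. -/
noncomputable def PushoutDiagram.ofHasPushouts [HasPushouts C] : PushoutDiagram D p n where
  G :=
    { obj j := pushout (p ≫ D.map j.hom) n
      map {j k} f := pushout.desc (D.map f.right ≫ pushout.inl _ _) (pushout.inr _ _) (by
        rw [← pushout.condition, Category.assoc, ← D.map_comp_assoc, Under.w f, Category.assoc])
      map_id j := by apply pushout.hom_ext <;> simp
      map_comp f g := by apply pushout.hom_ext <;> simp }
  inl j := pushout.inl _ _
  inr j := pushout.inr _ _
  inl_map φ := pushout.inl_desc _ _ _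
  inr_map φ := pushout.inr_desc _ _ _
  isPushout j := .of_hasPushout _ _

namespace PushoutDiagram

variable {D p n} (P : PushoutDiagram D p n) {c : Cocone D} {E : C} {f : c.pt ⟶ E} {g : B ⟶ E}

/-- The comparison with a pushout of `n` along `A ⟶ c.pt`. -/
noncomputable def leg (sq : IsPushout (p ≫ c.ι.app j₀) n f g) (j : Under j₀) : P.G.obj j ⟶ E :=
  (P.isPushout j).desc (c.ι.app j.right ≫ f) g (by simpa using sq.w)

lemma inl_leg (sq : IsPushout (p ≫ c.ι.app j₀) n f g) (j : Under j₀) :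
    P.inl j ≫ P.leg sq j = c.ι.app j.right ≫ f :=
  (P.isPushout j).inl_desc _ _ _

lemma inl_leg_assoc (sq : IsPushout (p ≫ c.ι.app j₀) n f g) (j : Under j₀) {Z : C} (x : E ⟶ Z) :
    P.inl j ≫ P.leg sq j ≫ x = c.ι.app j.right ≫ f ≫ x := by
  rw [← Category.assoc, inl_leg, Category.assoc]

lemma inr_leg (sq : IsPushout (p ≫ c.ι.app j₀) n f g) (j : Under j₀) :
    P.inr j ≫ P.leg sq j = g :=
  (P.isPushout j).inr_desc _ _ _

lemma inr_leg_assoc (sq : IsPushout (p ≫ c.ι.app j₀) n f g) (j : Under j₀) {Z : C} (x : E ⟶ Z) :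
    P.inr j ≫ P.leg sq j ≫ x = g ≫ x := by
  rw [← Category.assoc, inr_leg]

/-- The cocone given by a pushout of `n` along `A ⟶ c.pt`. -/
noncomputable def cocone (sq : IsPushout (p ≫ c.ι.app j₀) n f g) : Cocone P.G where
  pt := E
  ι :=
    { app := P.leg sq
      naturality j k φ := by
        apply (P.isPushout j).hom_ext
        · simp [reassoc_of% (P.inl_map φ), P.inl_leg]
        · simp [reassoc_of% (P.inr_map φ), P.inr_leg] }

/-- The pushouts of `n` over a filtered diagram have the pushout of `n` over its
colimit as their colimit. -/
noncomputable def isColimitCocone [IsFiltered J] (hc : IsColimit c)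
    (sq : IsPushout (p ≫ c.ι.app j₀) n f g) : IsColimit (P.cocone sq) := by
  -- As `J` is filtered, `Under j₀ ⥤ J` is final.
  have hc' : IsColimit (c.whisker (Under.forget j₀)) :=
    (Functor.Final.isColimitWhiskerEquiv (Under.forget j₀) c).symm hc
  let t (s : Cocone P.G) : Cocone (Under.forget j₀ ⋙ D) :=
    { pt := s.pt
      ι :=
        { app j := P.inl j ≫ s.ι.app j
          naturality j k φ := by
            have := P.inl j ≫= s.w φ
            rw [reassoc_of% (P.inl_map φ)] at this
            simpa using this } }
  have hc'' (s : Cocone P.G) (j : Under j₀) :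
      c.ι.app j.right ≫ hc'.desc (t s) = P.inl j ≫ s.ι.app j := hc'.fac (t s) j
  have hinr (s : Cocone P.G) (j : Under j₀) :
      P.inr j ≫ s.ι.app j = P.inr (Under.mk (𝟙 j₀)) ≫ s.ι.app (Under.mk (𝟙 j₀)) := by
    have := P.inr _ ≫= s.w (Under.homMk j.hom : Under.mk (𝟙 j₀) ⟶ j)
    rwa [reassoc_of% (P.inr_map _)] at this
  have hw (s : Cocone P.G) : (p ≫ c.ι.app j₀) ≫ hc'.desc (t s) =
      n ≫ P.inr (Under.mk (𝟙 j₀)) ≫ s.ι.app (Under.mk (𝟙 j₀)) := by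
    have h := hc'' s (Under.mk (𝟙 j₀))
    have h' := (P.isPushout (Under.mk (𝟙 j₀))).w =≫ s.ι.app _
    dsimp at h h'
    rw [D.map_id, Category.comp_id, Category.assoc, Category.assoc] at h'
    rw [Category.assoc, h, h']
  exact
    { desc s := sq.desc (hc'.desc (t s)) _ (hw s)
      fac s j := by
        apply (P.isPushout j).hom_ext
        · change P.inl j ≫ P.leg sq j ≫ sq.desc _ _ _ = _
          rw [P.inl_leg_assoc, sq.inl_desc, hc'']
        · change P.inr j ≫ P.leg sq j ≫ sq.desc _ _ _ = _
          rw [P.inr_leg_assoc, sq.inr_desc, hinr s j]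
      uniq s m hm := by
        apply sq.hom_ext
        · rw [sq.inl_desc]
          refine hc'.hom_ext (fun j => ?_)
          rw [hc'.fac]
          dsimp [t]
          rw [← hm]
          exact (P.inl_leg_assoc sq j m).symm
        · rw [sq.inr_desc, ← hm]
          exact (P.inr_leg_assoc sq _ m).symm }

end PushoutDiagram

end PushoutDiagram

variable {C : Type u} [Category.{v} C] {κ : Cardinal.{w}} [Fact κ.IsRegular]

/-! ### Presentable objects and closure properties -/

section Presentable

lemma isCardinalPresentable_of_isPushout [LocallySmall.{w} C] {X Y Z T : C} {f : X ⟶ Y}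
    {g : X ⟶ Z} {h : Y ⟶ T} {i : Z ⟶ T} (sq : IsPushout f g h i) (hX : IsCardinalPresentable X κ)
    (hY : IsCardinalPresentable Y κ) (hZ : IsCardinalPresentable Z κ) :
    IsCardinalPresentable T κ := by
  have : ∀ k, IsCardinalPresentable ((span f g).obj k) κ := by
    rintro (_ | _ | _)
    exacts [hX, hY, hZ]
  exact isCardinalPresentable_of_isColimit _ sq.isColimit κ
    (hasCardinalLT_of_finite _ _ (Cardinal.IsRegular.aleph0_le Fact.out))

lemma isCardinalPresentable_of_cofan [LocallySmall.{w} C] {ι : Type w}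
    (hι : HasCardinalLT ι κ) {X : ι → C} {c : Cofan X} (hc : IsColimit c)
    (hX : ∀ i, IsCardinalPresentable (X i) κ) :
    IsCardinalPresentable c.pt κ := by
  have : ∀ k, IsCardinalPresentable ((Discrete.functor X).obj k) κ := fun k => hX k.as
  exact isCardinalPresentable_of_isColimit _ hc κ (by simpa using hι)

lemma isCardinalPresentable_initial [LocallySmall.{w} C] [HasInitial C] :
    IsCardinalPresentable (⊥_ C) κ := by
  have : ∀ k, IsCardinalPresentable ((Functor.empty.{0} C).obj k) κ := fun k => k.as.elim
  exact isCardinalPresentable_of_isColimit _ (colimit.isColimit (Functor.empty.{0} C)) κ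
    (hasCardinalLT_of_finite _ _ (Cardinal.IsRegular.aleph0_le Fact.out))

end Presentable

section Closure

lemma injectiveObjects_pi (M : MorphismProperty C) {ι : Type*} (K : ι → C) [HasProduct K]
    (hK : ∀ i, injectiveObjects M (K i)) : injectiveObjects M (∏ᶜ K) := by
  intro A B n hn x
  choose y hy using fun i => hK i n hn (x ≫ Pi.π K i)
  exact ⟨Pi.lift y, Pi.hom_ext _ _ (fun i => by simp [hy])⟩

lemma orthogonalObjects_pi (M : MorphismProperty C) {ι : Type*} (K : ι → C) [HasProduct K]
    (hK : ∀ i, orthogonalObjects M (K i)) : orthogonalObjects M (∏ᶜ K) := by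
  intro A B n hn x
  choose y hy hy' using fun i => hK i n hn (x ≫ Pi.π K i)
  refine ⟨Pi.lift y, Pi.hom_ext _ _ (fun i => by simp [hy]), fun z hz => ?_⟩
  refine Pi.hom_ext _ _ (fun i => ?_)
  simpa using hy' i (z ≫ Pi.π K i) (by simp [reassoc_of% hz])

lemma closedUnderFilteredColimits_injectiveObjects {N : MorphismProperty C}
    (hN : N ≤ betweenPresentables C κ) :
    ClosedUnderFilteredColimits κ (injectiveObjects N) := by
  refine fun J _ _ => ⟨?_⟩
  rintro X ⟨pr⟩ A B n hn x
  have := (hN n hn).1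
  have : EssentiallySmall.{w} J := essentiallySmall_of_small_of_locallySmall J
  obtain ⟨j, x', rfl⟩ := IsCardinalPresentable.exists_hom_of_isColimit κ pr.isColimit x
  obtain ⟨y, hy⟩ := pr.prop_diag_obj j n hn x'
  exact ⟨y ≫ pr.ι.app j, by rw [reassoc_of% hy]⟩

lemma closedUnderFilteredColimits_orthogonalObjects {N : MorphismProperty C}
    (hN : N ≤ betweenPresentables C κ) :
    ClosedUnderFilteredColimits κ (orthogonalObjects N) := by
  refine fun J _ _ => ⟨?_⟩
  rintro X ⟨pr⟩ A B n hn x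
  have := (hN n hn).1
  have := (hN n hn).2
  have : EssentiallySmall.{w} J := essentiallySmall_of_small_of_locallySmall J
  obtain ⟨j, x', rfl⟩ := IsCardinalPresentable.exists_hom_of_isColimit κ pr.isColimit x
  obtain ⟨y, hy, -⟩ := pr.prop_diag_obj j n hn x'
  refine ⟨y ≫ pr.ι.app j, by dsimp; rw [reassoc_of% hy], fun z hz => ?_⟩
  dsimp at hz
  obtain ⟨k, z', rfl⟩ := IsCardinalPresentable.exists_hom_of_isColimit κ pr.isColimit z
  obtain ⟨l, a, b, h⟩ := IsCardinalPresentable.exists_eq_of_isColimit κ pr.isColimit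
    (n ≫ z') x' (by simpa using hz)
  have : z' ≫ pr.diag.map a = y ≫ pr.diag.map b :=
    (pr.prop_diag_obj l n hn (x' ≫ pr.diag.map b)).unique (by simpa using h)
      (by simp [reassoc_of% hy])
  have := this =≫ pr.ι.app l
  simpa using this

end Closure

/-! ### Descent of extension properties along filtered colimits -/

section Extension

/-- The functor sending `j` to the product of the objects `K t`, over all `t` and all
morphisms `D.obj j ⟶ K t`. -/
noncomputable def evaluationProduct {J : Type w} [SmallCategory J] (D : J ⥤ C) {T : Type w}
    (K : T → C) [∀ j, HasProduct (fun q : Σ t, D.obj j ⟶ K t => K q.1)] : J ⥤ C where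
  obj j := ∏ᶜ (fun q : Σ t, D.obj j ⟶ K t => K q.1)
  map {j k} f := Pi.lift (fun q => Pi.π (fun q : Σ t, D.obj j ⟶ K t => K q.1) ⟨q.1, D.map f ≫ q.2⟩)
  map_id j := Pi.hom_ext _ _ (fun ⟨t, x⟩ => by
    rw [Pi.lift_π, Category.id_comp]
    congr 2
    simp)
  map_comp f g := Pi.hom_ext _ _ (fun ⟨t, x⟩ => by
    rw [Category.assoc, Pi.lift_π, Pi.lift_π, Pi.lift_π]
    congr 2
    simp)

namespace evaluationProduct

variable {J : Type w} [SmallCategory J] {D : J ⥤ C} {T : Type w} {K : T → C}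
  [∀ j, HasProduct (fun q : Σ t, D.obj j ⟶ K t => K q.1)]

/-- The projection of `evaluationProduct D K` to the factor given by `x : D.obj j ⟶ K t`. -/
noncomputable def π {j : J} {t : T} (x : D.obj j ⟶ K t) : (evaluationProduct D K).obj j ⟶ K t :=
  Pi.π (fun q : Σ t, D.obj j ⟶ K t => K q.1) ⟨t, x⟩

variable (D K) in
/-- The canonical morphism from `D` to `evaluationProduct D K`. -/
noncomputable def ev : D ⟶ evaluationProduct D K where
  app j := Pi.lift (fun q => q.2)
  naturality j k f := Pi.hom_ext _ _ (fun q => by simp [evaluationProduct])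

lemma ev_π {j : J} {t : T} (x : D.obj j ⟶ K t) : (ev D K).app j ≫ π x = x :=
  Pi.lift_π _ _

end evaluationProduct

/-- Let `P` be closed under products and `κ`-filtered colimits. If the restriction of every morphism
`c.pt ⟶ K` with `K` in `P` to the `κ`-presentable object `A` extends along `n`, then the same holds
already at some stage `D.obj j` of the `κ`-filtered diagram `D` with colimit `c.pt`.

Otherwise there are counterexamples `x t : D.obj t ⟶ K t` at all stages `t`. The products of the
`K t` over all morphisms `D.obj j ⟶ K t` form a diagram `R` of members of `P`, with a
canonical `D ⟶ R`. An extension into `colimit R`, which is in `P`, factors through some stage of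
`R`, and its components there contradict the choice of `x`. -/
theorem exists_extension_of_isColimit [LocallySmall.{w} C] [HasLimitsOfSize.{w, w} C]
    [HasColimitsOfSize.{w, w} C] {P : ObjectProperty C}
    (hP : ClosedUnderFilteredColimits κ P)
    (hP' : ∀ {ι : Type (max v w)} (K : ι → C) [HasProduct K], (∀ i, P (K i)) → P (∏ᶜ K))
    {J : Type w} [SmallCategory J] [IsCardinalFiltered J κ] {D : J ⥤ C} {c : Cocone D}
    (hc : IsColimit c) {j₀ : J} {A B : C} [IsCardinalPresentable A κ] [IsCardinalPresentable B κ]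
    (n : A ⟶ B) (p : A ⟶ D.obj j₀)
    (h : ∀ K, P K → ∀ x : c.pt ⟶ K, ∃ y : B ⟶ K, n ≫ y = p ≫ c.ι.app j₀ ≫ x) :
    ∃ (j : J) (a : j₀ ⟶ j), ∀ K, P K → ∀ x : D.obj j ⟶ K, ∃ y : B ⟶ K,
      n ≫ y = p ≫ D.map a ≫ x := by
  by_contra! H
  choose K hK x hx using fun t : Under j₀ => H t.right t.hom
  have : ∀ j, HasProduct (fun q : Σ t, D.obj j ⟶ K t => K q.1) := fun j => by
    have : HasLimitsOfShape (Discrete (Σ t, D.obj j ⟶ K t)) C :=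
      hasLimitsOfShape_of_equivalence (Discrete.equivalence (equivShrink.{w} _)).symm
    infer_instance
  have := hP J
  have : EssentiallySmall.{w} J := essentiallySmall_of_small_of_locallySmall J
  let R := evaluationProduct D K
  have hR : ∀ j, P (R.obj j) := fun j => hP' _ (fun q => hK q.1)
  obtain ⟨y, hy⟩ := h (colimit R) (P.prop_colimit R hR)
    (hc.desc ((Cocone.precompose (evaluationProduct.ev D K)).obj (colimit.cocone R)))
  obtain ⟨j, y', rfl⟩ := IsCardinalPresentable.exists_hom_of_isColimit κ (colimit.isColimit R) y
  obtain ⟨k, a, b, hab⟩ := IsCardinalPresentable.exists_eq_of_isColimit κ (colimit.isColimit R)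
    (n ≫ y') (p ≫ (evaluationProduct.ev D K).app j₀) (by simpa using hy)
  refine hx (Under.mk b) (y' ≫ R.map a ≫ evaluationProduct.π (x (Under.mk b))) ?_
  have := hab =≫ evaluationProduct.π (x (Under.mk b))
  simp only [Category.assoc, R, ← NatTrans.naturality_assoc, evaluationProduct.ev_π] at this
  exact this

end Extension

section Injectivity

/-! ### Presentable morphisms as pushouts in the closed case -/

variable [IsCardinalLocallyPresentable C κ] {P : ObjectProperty C}
    (hP : ClosedUnderFilteredColimits κ P)
    (hP' : ∀ {ι : Type (max v w)} (K : ι → C) [HasProduct K], (∀ i, P (K i)) → P (∏ᶜ K))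

include hP hP'

/-- The key step towards generating morphisms between `κ`-presentable objects: a pushout `m` of
`n : A₀ ⟶ B₀` along `A₀ ⟶ A` is the pushout of the pushouts of `n` along `A₀ ⟶ D j`, for a
`κ`-filtered diagram `D` of `κ`-presentable objects with colimit `A`. One of these has all members
of `P` injective with respect to it as soon as `m` has. -/
theorem pushouts_injectiveMorphisms {A B : C} {m : A ⟶ B}
    (hm : (betweenPresentables C κ).pushouts m) (hmP : injectiveMorphisms P m) :
    (injectiveMorphisms P ⊓ betweenPresentables C κ).pushouts m := by
  have := hasLimitsOfSize_of_isCardinalLocallyPresentable (C := C) κ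
  obtain ⟨A₀, B₀, n, p, q, ⟨hA₀, hB₀⟩, sq⟩ := hm
  obtain ⟨J, _, _, ⟨pr⟩⟩ :=
    (isCardinalFilteredGenerator_isCardinalPresentable C κ).exists_colimitsOfShape A
  have : EssentiallySmall.{w} J := essentiallySmall_of_small_of_locallySmall J
  obtain ⟨j₀, p, rfl⟩ := IsCardinalPresentable.exists_hom_of_isColimit κ pr.isColimit p
  dsimp at sq
  obtain ⟨j, a, h⟩ := exists_extension_of_isColimit hP hP' pr.isColimit n p (by
    intro K hK x
    obtain ⟨y, rfl⟩ := hmP K hK x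
    exact ⟨q ≫ y, by simp [← reassoc_of% sq.w]⟩)
  have sq' := IsPushout.of_hasPushout (p ≫ pr.diag.map a) n
  refine ⟨_, _, pushout.inl (p ≫ pr.diag.map a) n, pr.ι.app j,
    _, ⟨fun K hK x => ?_, pr.prop_diag_obj j,
      isCardinalPresentable_of_isPushout sq' hA₀ (pr.prop_diag_obj j) hB₀⟩,
    IsPushout.of_left' (h₁₂ := pr.ι.app j) (by simpa using sq) sq'⟩
  obtain ⟨y, hy⟩ := h K hK x
  exact ⟨sq'.desc x y (by simp [hy]), by simp⟩

/-- The analogue of `pushouts_injectiveMorphisms` for orthogonality. Existence of extensions is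
obtained at a stage `j` as there. Uniqueness is an extension property too: let `S` be the pushout of
`n` along itself. Then `K` admits at most one extension of each morphism along the pushout of `n` if
and only if the restriction to `S` of every morphism to `K` from the pushout of `A₀ ⟶ S` factors
through the codiagonal `S ⟶ B₀`. This is achieved at a later stage `k`. -/
theorem pushouts_orthogonalMorphisms {A B : C} {m : A ⟶ B}
    (hm : (betweenPresentables C κ).pushouts m) (hmP : orthogonalMorphisms P m) :
    (orthogonalMorphisms P ⊓ betweenPresentables C κ).pushouts m := by
  have := hasLimitsOfSize_of_isCardinalLocallyPresentable (C := C) κ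
  obtain ⟨A₀, B₀, n, p, q, ⟨hA₀, hB₀⟩, sq⟩ := hm
  obtain ⟨J, _, _, ⟨pr⟩⟩ :=
    (isCardinalFilteredGenerator_isCardinalPresentable C κ).exists_colimitsOfShape A
  have : EssentiallySmall.{w} J := essentiallySmall_of_small_of_locallySmall J
  have := isFiltered_of_isCardinalFiltered J κ
  obtain ⟨j₀, p, rfl⟩ := IsCardinalPresentable.exists_hom_of_isColimit κ pr.isColimit p
  dsimp at sq
  obtain ⟨j, a, h⟩ := exists_extension_of_isColimit hP hP' pr.isColimit n p (by
    intro K hK x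
    obtain ⟨y, rfl, -⟩ := hmP K hK x
    exact ⟨q ≫ y, by simp [← reassoc_of% sq.w]⟩)
  obtain ⟨p₁, hp₁⟩ : ∃ p₁, p₁ = p ≫ pr.diag.map a := ⟨_, rfl⟩
  have sq₁ : IsPushout (p₁ ≫ pr.ι.app j) n m q := by simpa [hp₁] using sq
  have sqS := IsPushout.of_hasPushout n n
  have hS := isCardinalPresentable_of_isPushout sqS hA₀ hB₀ hB₀
  have : IsCardinalPresentable _ κ := hS
  -- Pushouts of `s` consist of two copies of the pushout of `n`, glued along its source.
  let s := n ≫ pushout.inl n n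
  let Pd := PushoutDiagram.ofHasPushouts pr.diag p₁ s
  have sqE := IsPushout.of_hasPushout (p₁ ≫ pr.cocone.ι.app j) s
  obtain ⟨k, b, h'⟩ := exists_extension_of_isColimit hP hP' (Pd.isColimitCocone pr.isColimit sqE)
    (j₀ := Under.mk (𝟙 j)) (sqS.desc (𝟙 B₀) (𝟙 B₀) rfl) (Pd.inr _) (by
      intro K hK x
      obtain ⟨y₁, hy₁⟩ : ∃ y₁, y₁ = pushout.inl n n ≫ pushout.inr (p₁ ≫ pr.cocone.ι.app j) s ≫ x :=
        ⟨_, rfl⟩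
      obtain ⟨y₂, hy₂⟩ : ∃ y₂, y₂ = pushout.inr n n ≫ pushout.inr (p₁ ≫ pr.cocone.ι.app j) s ≫ x :=
        ⟨_, rfl⟩
      have h₁ : (p₁ ≫ pr.ι.app j) ≫ pushout.inl (p₁ ≫ pr.cocone.ι.app j) s ≫ x = n ≫ y₁ := by
        rw [hy₁, ← Category.assoc n]
        exact sqE.w_assoc x
      have h₂ : (p₁ ≫ pr.ι.app j) ≫ pushout.inl (p₁ ≫ pr.cocone.ι.app j) s ≫ x = n ≫ y₂ := by
        rw [h₁, hy₁, hy₂, pushout.condition_assoc]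
      have h₃ : sq₁.desc _ _ h₁ = sq₁.desc _ _ h₂ :=
        (hmP K hK (pushout.inl (p₁ ≫ pr.cocone.ι.app j) s ≫ x)).unique
          (sq₁.inl_desc _ _ _) (sq₁.inl_desc _ _ _)
      have h₄ : y₁ = y₂ := by rw [← sq₁.inr_desc _ _ h₁, h₃, sq₁.inr_desc]
      have h₅ : ∀ j', Pd.inr j' ≫ (Pd.cocone sqE).ι.app j' ≫ x = pushout.inr _ _ ≫ x :=
        fun j' => Pd.inr_leg_assoc sqE j' x
      refine ⟨y₁, ?_⟩
      rw [h₅]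
      apply sqS.hom_ext
      · rw [sqS.inl_desc_assoc, Category.id_comp, hy₁]
      · rw [sqS.inr_desc_assoc, Category.id_comp, h₄, hy₂])
  have sq' := IsPushout.of_hasPushout (p₁ ≫ pr.diag.map k.hom) n
  refine ⟨_, _, pushout.inl (p₁ ≫ pr.diag.map k.hom) n, pr.ι.app k.right,
    _, ⟨fun K hK x => ?_, pr.prop_diag_obj k.right,
      isCardinalPresentable_of_isPushout sq' hA₀ (pr.prop_diag_obj k.right) hB₀⟩,
    IsPushout.of_left' (h₁₂ := pr.ι.app k.right) (by simpa using sq₁) sq'⟩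
  obtain ⟨y, hy⟩ := h K hK (pr.diag.map k.hom ≫ x)
  refine ⟨sq'.desc x y (by simp [hy, hp₁]), by simp, fun z hz => ?_⟩
  have key : ∀ z₁ z₂ : B₀ ⟶ K, n ≫ z₁ = (p₁ ≫ pr.diag.map k.hom) ≫ x →
      n ≫ z₂ = (p₁ ≫ pr.diag.map k.hom) ≫ x → z₁ = z₂ := by
    intro z₁ z₂ h₁ h₂
    obtain ⟨t, ht⟩ := h' K hK ((Pd.isPushout k).desc x (sqS.desc z₁ z₂ (h₁.trans h₂.symm)) (by
      simp [s, sqS.inl_desc, h₁]))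
    rw [reassoc_of% (Pd.inr_map b), (Pd.isPushout k).inr_desc] at ht
    have h₃ := pushout.inl n n ≫= ht
    have h₄ := pushout.inr n n ≫= ht
    rw [sqS.inl_desc, sqS.inl_desc_assoc, Category.id_comp] at h₃
    rw [sqS.inr_desc, sqS.inr_desc_assoc, Category.id_comp] at h₄
    rw [← h₃, h₄]
  apply sq'.hom_ext
  · rw [hz, sq'.inl_desc]
  · rw [sq'.inr_desc]
    refine key _ _ ?_ (by simp [hy, hp₁])
    rw [← sq'.w_assoc, hz]

end Injectivity

variable {C : Type u} [Category.{v} C]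

/-! ### Orthogonal classes of morphisms -/

section LeftOrthogonal

variable {R : MorphismProperty C}

lemma leftOrthogonal_of_isIso {A B : C} (e : A ⟶ B) [IsIso e] : leftOrthogonal R e := by
  intro X Y i _ f g h
  refine ⟨inv e ≫ f, ⟨by simp, by simp [h]⟩, fun d hd => by simp [← hd.1]⟩

lemma leftOrthogonal_comp {A B D : C} {p : A ⟶ B} {q : B ⟶ D} (hp : leftOrthogonal R p)
    (hq : leftOrthogonal R q) : leftOrthogonal R (p ≫ q) := by
  intro X Y i hi f g h
  obtain ⟨d, ⟨hd₁, hd₂⟩, hd⟩ := hp i hi f (q ≫ g) (by simpa using h)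
  obtain ⟨e, ⟨he₁, he₂⟩, he⟩ := hq i hi d g hd₂
  refine ⟨e, ⟨by simp [he₁, hd₁], he₂⟩, fun e' ⟨h₁, h₂⟩ => he e' ⟨?_, h₂⟩⟩
  exact hd (q ≫ e') ⟨by simpa using h₁, by simp [h₂]⟩

/-- If `p` and `p ≫ q` are left orthogonal to `R`, so is `q`. -/
lemma leftOrthogonal_of_comp {A B D : C} {p : A ⟶ B} {q : B ⟶ D} (hp : leftOrthogonal R p)
    (hpq : leftOrthogonal R (p ≫ q)) : leftOrthogonal R q := by
  intro X Y i hi f g h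
  obtain ⟨d, ⟨hd₁, hd₂⟩, hd⟩ := hpq i hi (p ≫ f) g (by simp [h])
  refine ⟨d, ⟨?_, hd₂⟩, fun d' hd' => hd d' ⟨by simp [hd'.1], hd'.2⟩⟩
  exact (hp i hi (p ≫ f) (q ≫ g) (by simp [h])).unique
    ⟨by simpa using hd₁, by simp [hd₂]⟩ ⟨rfl, h⟩

lemma leftOrthogonal_of_isPushout {A B A' B' : C} {f : A ⟶ A'} {p : A ⟶ B} {p' : A' ⟶ B'}
    {g : B ⟶ B'} (sq : IsPushout f p p' g) (hp : leftOrthogonal R p) : leftOrthogonal R p' := by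
  intro X Y i hi a b h
  obtain ⟨d, ⟨hd₁, hd₂⟩, hd⟩ := hp i hi (f ≫ a) (g ≫ b) (by rw [Category.assoc, h, sq.w_assoc])
  refine ⟨sq.desc a d hd₁.symm, ⟨by simp, sq.hom_ext (by simp [h]) (by simp [hd₂])⟩,
    fun e he => sq.hom_ext (by simp [he.1]) ?_⟩
  rw [sq.inr_desc]
  exact hd _ ⟨by rw [← sq.w_assoc, he.1], by simp [he.2]⟩

lemma leftOrthogonal_sigmaMap {ι : Type*} {A B : ι → C} [HasCoproduct A] [HasCoproduct B]
    {n : ∀ i, A i ⟶ B i} (hn : ∀ i, leftOrthogonal R (n i)) :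
    leftOrthogonal R (Limits.Sigma.map n) := by
  intro X Y i hi a b h
  choose d hd hd' using fun k => hn k i hi (Sigma.ι A k ≫ a) (Sigma.ι B k ≫ b) (by
    rw [Category.assoc, h, Sigma.ι_map_assoc])
  refine ⟨Sigma.desc d, ⟨Sigma.hom_ext _ _ (fun k => ?_), Sigma.hom_ext _ _ (fun k => ?_)⟩,
    fun e he => Sigma.hom_ext _ _ (fun k => ?_)⟩
  · simp [hd]
  · simp [hd]
  · rw [Sigma.ι_desc]
    exact hd' _ _ ⟨by simp [← he.1], by simp [he.2]⟩

/-- The codiagonal of a morphism which is left orthogonal to `R` is left orthogonal to `R`. -/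
lemma leftOrthogonal_codiagonal {A B S : C} {n : A ⟶ B} {a b : B ⟶ S} (sq : IsPushout n n a b)
    (hn : leftOrthogonal R n) : leftOrthogonal R (sq.desc (𝟙 B) (𝟙 B) rfl) := by
  refine leftOrthogonal_of_comp (leftOrthogonal_of_isPushout sq hn) ?_
  rw [sq.inl_desc]
  exact leftOrthogonal_of_isIso _

/-- A member `f : A ⟶ B` of `filteredColimits κ Q` in terms of the morphisms to `B`: the colimit
cocone with point `B` is unbundled, so that its legs have a source of the form `(D.obj j).right`. -/
lemma filteredColimits.exists_diagram {κ : Cardinal.{w}} [Fact κ.IsRegular]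
    {Q : MorphismProperty C} {A B : C} {f : A ⟶ B} (hf : filteredColimits κ Q f) :
    ∃ (J : Type w) (_ : SmallCategory J) (_ : IsCardinalFiltered J κ) (D : J ⥤ Under A)
      (ι : ∀ j, (D.obj j).right ⟶ B), (∀ j, Q (D.obj j).hom) ∧ (∀ j, (D.obj j).hom ≫ ι j = f) ∧
      (∀ ⦃j k⦄ (φ : j ⟶ k), (D.map φ).right ≫ ι k = ι j) ∧
      (∀ ⦃Z⦄ (x y : B ⟶ Z), (∀ j, ι j ≫ x = ι j ≫ y) → x = y) ∧
      (∀ ⦃Z⦄ (d : ∀ j, (D.obj j).right ⟶ Z),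
        (∀ ⦃j k⦄ (φ : j ⟶ k), (D.map φ).right ≫ d k = d j) → ∃ y : B ⟶ Z, ∀ j, ι j ≫ y = d j) := by
  obtain ⟨J, _, _, D, c, hc, e, hD, hf⟩ := hf
  refine ⟨J, _, inferInstance, D, fun j => c.ι.app j ≫ e.hom, hD, hf, fun j k φ => ?_,
    fun Z x y h => ?_, fun Z d hd => ?_⟩
  · exact (Category.assoc _ _ _).symm.trans (congrArg (· ≫ e.hom) (c.w φ))
  · rw [← cancel_epi e.hom]
    exact hc.hom_ext (fun j =>
      ((Category.assoc _ _ _).symm.trans (h j)).trans (Category.assoc _ _ _))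
  · let s : Cocone (D ⋙ Under.forget A) :=
      { pt := Z
        ι :=
          { app := d
            naturality j k φ := (hd φ).trans (Category.comp_id _).symm } }
    refine ⟨e.inv ≫ hc.desc s, fun j => ?_⟩
    have := hc.fac s j
    exact (Category.assoc _ _ _).trans
      ((congrArg (c.ι.app j ≫ ·) (e.hom_inv_id_assoc _)).trans this)

lemma filteredColimits_le_leftOrthogonal {κ : Cardinal.{w}} [Fact κ.IsRegular]
    {Q : MorphismProperty C} (hQ : Q ≤ leftOrthogonal R) :
    filteredColimits κ Q ≤ leftOrthogonal R := by
  intro A B f hf X Y i hi a b h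
  obtain ⟨J, _, _, D, ι, hD, hf, hι, hext, hdesc⟩ := hf.exists_diagram
  choose d hd hd' using fun j => hQ _ (hD j) i hi a (ι j ≫ b) (by
    rw [h, ← hf j, Category.assoc])
  obtain ⟨y, hy⟩ := hdesc d (fun j k φ => hd' j _
    ⟨by simp [(hd k).1], by simp [(hd k).2, reassoc_of% (hι φ)]⟩)
  obtain ⟨j⟩ := IsCardinalFiltered.nonempty J κ
  refine ⟨y, ⟨by rw [← hf j, Category.assoc, hy, (hd j).1], hext _ _ (fun j => ?_)⟩,
    fun z hz => hext _ _ (fun j => ?_)⟩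
  · rw [reassoc_of% (hy j), (hd j).2]
  · rw [hy]
    exact hd' j _ ⟨by rw [← hz.1, ← hf j, Category.assoc], by rw [Category.assoc, hz.2]⟩

end LeftOrthogonal

lemma le_rightOrthogonal_leftOrthogonal (R : MorphismProperty C) :
    R ≤ rightOrthogonal (leftOrthogonal R) :=
  fun _ _ _ hi _ _ _ hp => hp _ hi

lemma le_leftOrthogonal_rightOrthogonal (N : MorphismProperty C) :
    N ≤ leftOrthogonal (rightOrthogonal N) :=
  fun _ _ _ hp _ _ _ hi => hi _ hp

lemma rightOrthogonal_anti {N N' : MorphismProperty C} (h : N ≤ N') :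
    rightOrthogonal N' ≤ rightOrthogonal N :=
  fun _ _ _ hi _ _ p hp => hi p (h p hp)

variable {κ : Cardinal.{w}} [Fact κ.IsRegular]

/-- The morphisms between `κ`-presentable objects which are left orthogonal to `R`. -/
def presentableLeftOrthogonal (κ : Cardinal.{w}) [Fact κ.IsRegular] (R : MorphismProperty C) :
    MorphismProperty C :=
  leftOrthogonal R ⊓ betweenPresentables C κ

/-- As the `κ`-presentable objects form an essentially small category, a class of morphisms
between them is generated by a small part of it. Isomorphic arrows are pushouts of each other. -/
lemma exists_isSmall_le_pushouts [HasCardinalFilteredGenerator C κ] {W : MorphismProperty C}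
    (hW : W ≤ betweenPresentables C κ) :
    ∃ N : MorphismProperty C, MorphismProperty.IsSmall.{w} N ∧ N ≤ W ∧ W ≤ N.pushouts := by
  obtain ⟨P, _, hP, hP'⟩ :=
    ObjectProperty.EssentiallySmall.exists_small_le.{w} (isCardinalPresentable C κ)
  let T := {x : Σ (A B : Subtype P), A.1 ⟶ B.1 // ∃ (A B : C) (n : A ⟶ B),
    W n ∧ Nonempty (Arrow.mk n ≅ Arrow.mk x.2.2)}
  choose A B n hn e using fun x : T => x.2
  have : Small.{w} (Subtype P) := inferInstance
  have : Small.{w} T := inferInstance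
  refine ⟨.ofHoms n, MorphismProperty.isSmall_ofHoms n, ?_, fun X Y f hf => ?_⟩
  · rintro _ _ _ ⟨x⟩
    exact hn x
  · obtain ⟨X', hX', ⟨eX⟩⟩ := hP' _ (hW f hf).1
    obtain ⟨Y', hY', ⟨eY⟩⟩ := hP' _ (hW f hf).2
    have e' : Arrow.mk f ≅ Arrow.mk (eX.inv ≫ f ≫ eY.hom) := Arrow.isoMk eX eY
    let x : T := ⟨⟨⟨X', hX'⟩, ⟨Y', hY'⟩, eX.inv ≫ f ≫ eY.hom⟩, _, _, f, hf, ⟨e'⟩⟩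
    exact (MorphismProperty.arrow_mk_iso_iff _ ((e x).some ≪≫ e'.symm)).1
      (MorphismProperty.le_pushouts _ _ (MorphismProperty.ofHoms.mk x))

/-! ### Pushouts of morphisms between presentable objects -/

section Factorization

variable {C : Type u} [Category.{v} C] {κ : Cardinal.{w}} [Fact κ.IsRegular]
  {R : MorphismProperty C}

lemma presentableLeftOrthogonal_comp {A B D : C} {p : A ⟶ B} {q : B ⟶ D}
    (hp : presentableLeftOrthogonal κ R p) (hq : presentableLeftOrthogonal κ R q) :
    presentableLeftOrthogonal κ R (p ≫ q) :=
  ⟨leftOrthogonal_comp hp.1 hq.1, hp.2.1, hq.2.2⟩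

lemma pushouts_presentableLeftOrthogonal_le :
    (presentableLeftOrthogonal κ R).pushouts ≤ leftOrthogonal R := by
  rintro X Y f ⟨_, _, _, _, _, hn, sq⟩
  exact leftOrthogonal_of_isPushout sq hn.1

variable [IsCardinalLocallyPresentable C κ]

lemma presentableLeftOrthogonal_of_isPushout {A B A' B' : C} {f : A ⟶ A'} {p : A ⟶ B}
    {p' : A' ⟶ B'} {g : B ⟶ B'} (sq : IsPushout f p p' g) (hp : presentableLeftOrthogonal κ R p)
    (hA' : IsCardinalPresentable A' κ) : presentableLeftOrthogonal κ R p' :=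
  ⟨leftOrthogonal_of_isPushout sq hp.1, hA',
    isCardinalPresentable_of_isPushout sq hp.2.1 hA' hp.2.2⟩

lemma presentableLeftOrthogonal_sigmaMap {ι : Type w} (hι : HasCardinalLT ι κ) {A B : ι → C}
    {n : ∀ i, A i ⟶ B i} (hn : ∀ i, presentableLeftOrthogonal κ R (n i)) :
    presentableLeftOrthogonal κ R (Limits.Sigma.map n) :=
  ⟨leftOrthogonal_sigmaMap (fun i => (hn i).1),
    isCardinalPresentable_of_cofan hι (colimit.isColimit _) (fun i => (hn i).2.1),
    isCardinalPresentable_of_cofan hι (colimit.isColimit _) (fun i => (hn i).2.2)⟩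

lemma presentableLeftOrthogonal_codiagonal {A B S : C} {n : A ⟶ B} {a b : B ⟶ S}
    (sq : IsPushout n n a b) (hn : presentableLeftOrthogonal κ R n) :
    presentableLeftOrthogonal κ R (sq.desc (𝟙 B) (𝟙 B) rfl) :=
  ⟨leftOrthogonal_codiagonal sq hn.1,
    isCardinalPresentable_of_isPushout sq hn.2.1 hn.2.2 hn.2.2, hn.2.2⟩

/-- Both morphisms of a composite arise at a common stage of a `κ`-filtered diagram of
`κ`-presentable objects with colimit `X`. -/
theorem pushouts_presentableLeftOrthogonal_comp {X Y Z : C} {f : X ⟶ Y} {g : Y ⟶ Z}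
    (hf : (presentableLeftOrthogonal κ R).pushouts f)
    (hg : (presentableLeftOrthogonal κ R).pushouts g) :
    (presentableLeftOrthogonal κ R).pushouts (f ≫ g) := by
  obtain ⟨A₁, B₁, n₁, p₁, q₁, hn₁, sq₁⟩ := hf
  obtain ⟨A₂, B₂, n₂, p₂, q₂, hn₂, sq₂⟩ := hg
  have := hn₁.2.1
  have := hn₂.2.1
  obtain ⟨J, _, _, ⟨pr⟩⟩ :=
    (isCardinalFilteredGenerator_isCardinalPresentable C κ).exists_colimitsOfShape X
  have : EssentiallySmall.{w} J := essentiallySmall_of_small_of_locallySmall J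
  have := isFiltered_of_isCardinalFiltered J κ
  obtain ⟨j₀, p₁, rfl⟩ := IsCardinalPresentable.exists_hom_of_isColimit κ pr.isColimit p₁
  let Pd := PushoutDiagram.ofHasPushouts pr.diag p₁ n₁
  obtain ⟨k, p₂', hp₂⟩ :=
    IsCardinalPresentable.exists_hom_of_isColimit κ (Pd.isColimitCocone pr.isColimit sq₁) p₂
  replace hp₂ : p₂' ≫ Pd.leg sq₁ k = p₂ := hp₂
  have sqk : IsPushout (pr.ι.app k.right) (Pd.inl k) f (Pd.leg sq₁ k) :=
    IsPushout.of_left' (h₁₂ := pr.ι.app k.right) (by simpa using sq₁) (Pd.isPushout k)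
  have sq₃ := IsPushout.of_hasPushout p₂' n₂
  have sqm := IsPushout.of_left' (h₁₂ := Pd.leg sq₁ k) (by rwa [hp₂]) sq₃
  exact MorphismProperty.pushouts_mk _ (sqk.paste_vert sqm)
    (presentableLeftOrthogonal_comp
      (presentableLeftOrthogonal_of_isPushout (Pd.isPushout k) hn₁ (pr.prop_diag_obj _))
      (presentableLeftOrthogonal_of_isPushout sq₃ hn₂
        (isCardinalPresentable_of_isPushout (Pd.isPushout k) hn₁.2.1 (pr.prop_diag_obj _) hn₁.2.2)))

/-- A family of fewer than `κ` pushouts with the same source has a colimit that is again such a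
pushout, namely of the coproduct of the generating morphisms. -/
theorem pushouts_presentableLeftOrthogonal_wideSpan {ι : Type w} (hι : HasCardinalLT ι κ) {X : C}
    {Y : ι → C} (f : ∀ i, X ⟶ Y i) (hf : ∀ i, (presentableLeftOrthogonal κ R).pushouts (f i)) :
    ∃ (Z : C) (z : X ⟶ Z) (h : ∀ i, Y i ⟶ Z), (presentableLeftOrthogonal κ R).pushouts z ∧
      (∀ i, f i ≫ h i = z) ∧ ∀ ⦃T : C⦄ (t : X ⟶ T) (t' : ∀ i, Y i ⟶ T),
        (∀ i, f i ≫ t' i = t) → ∃ s : Z ⟶ T, z ≫ s = t ∧ ∀ i, h i ≫ s = t' i := by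
  choose A B n p q hn sq using hf
  have sq' := IsPushout.of_hasPushout (Sigma.desc p) (Limits.Sigma.map n)
  have hw (i) : p i ≫ pushout.inl (Sigma.desc p) (Limits.Sigma.map n) =
      n i ≫ Sigma.ι B i ≫ pushout.inr (Sigma.desc p) (Limits.Sigma.map n) := by
    rw [← Sigma.ι_desc p i, Category.assoc, sq'.w, Sigma.ι_map_assoc]
  refine ⟨_, pushout.inl (Sigma.desc p) (Limits.Sigma.map n), fun i => (sq i).desc _ _ (hw i),
    MorphismProperty.pushouts_mk _ sq' (presentableLeftOrthogonal_sigmaMap hι hn),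
    fun i => (sq i).inl_desc _ _ _, fun T t t' h => ?_⟩
  refine ⟨sq'.desc t (Sigma.desc (fun i => q i ≫ t' i)) (Sigma.hom_ext _ _ (fun i => ?_)),
    sq'.inl_desc _ _ _, fun i => (sq i).hom_ext ?_ ?_⟩
  · rw [Sigma.ι_desc_assoc, Sigma.ι_map_assoc, Sigma.ι_desc, ← h i, (sq i).w_assoc]
  · rw [(sq i).inl_desc_assoc, sq'.inl_desc, h]
  · rw [(sq i).inr_desc_assoc, Category.assoc, sq'.inr_desc, Sigma.ι_desc]

/-- Fewer than `κ` morphisms that agree after precomposition with a pushout `f` of some `n` have a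
coequalizer that is again such a pushout, namely of a coproduct of codiagonals of `n`. -/
theorem pushouts_presentableLeftOrthogonal_coeq {ι : Type w} (hι : HasCardinalLT ι κ) [Nonempty ι]
    {X Y₁ Y₂ : C} {f : X ⟶ Y₁} (hf : (presentableLeftOrthogonal κ R).pushouts f)
    (g : ι → (Y₁ ⟶ Y₂)) (hg : ∀ i j, f ≫ g i = f ≫ g j) :
    ∃ (Z : C) (h : Y₂ ⟶ Z), (presentableLeftOrthogonal κ R).pushouts h ∧ Epi h ∧
      (∀ i j, g i ≫ h = g j ≫ h) ∧ ∀ ⦃T : C⦄ (t : Y₂ ⟶ T),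
        (∀ i j, g i ≫ t = g j ≫ t) → ∃ s : Z ⟶ T, h ≫ s = t := by
  obtain ⟨i₀⟩ := ‹Nonempty ι›
  obtain ⟨A, B, n, p, q, hn, sq⟩ := hf
  have sqS := IsPushout.of_hasPushout n n
  have hw (i) : n ≫ q ≫ g i₀ = n ≫ q ≫ g i := by
    rw [← sq.w_assoc, hg i₀ i, sq.w_assoc]
  let s (i : ι) := sqS.desc _ _ (hw i)
  let δ := sqS.desc (𝟙 B) (𝟙 B) rfl
  have sq' := IsPushout.of_hasPushout (Sigma.desc s) (Limits.Sigma.map (fun _ : ι => δ))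
  obtain ⟨h, hh⟩ : ∃ h, h = pushout.inl (Sigma.desc s) (Limits.Sigma.map (fun _ : ι => δ)) :=
    ⟨_, rfl⟩
  obtain ⟨r, hr⟩ : ∃ r, r = pushout.inr (Sigma.desc s) (Limits.Sigma.map (fun _ : ι => δ)) :=
    ⟨_, rfl⟩
  rw [← hh, ← hr] at sq'
  have hs (i) : s i ≫ h = δ ≫ Sigma.ι (fun _ => B) i ≫ r := by
    rw [← Sigma.ι_desc s i, Category.assoc, sq'.w, Sigma.ι_map_assoc]
  have h₁ (i) : (q ≫ g i₀) ≫ h = Sigma.ι (fun _ => B) i ≫ r := by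
    rw [← sqS.inl_desc _ _ (hw i), Category.assoc, hs, sqS.inl_desc_assoc, Category.id_comp]
  have h₂ (i) : (q ≫ g i) ≫ h = Sigma.ι (fun _ => B) i ≫ r := by
    rw [← sqS.inr_desc _ _ (hw i), Category.assoc, hs, sqS.inr_desc_assoc, Category.id_comp]
  have h₃ (i) : g i ≫ h = g i₀ ≫ h := by
    refine sq.hom_ext ?_ ?_
    · rw [← Category.assoc, ← Category.assoc, hg]
    · rw [← Category.assoc, ← Category.assoc, h₁ i, h₂ i]
  refine ⟨_, h, MorphismProperty.pushouts_mk _ sq'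
    (presentableLeftOrthogonal_sigmaMap hι
      (fun i => presentableLeftOrthogonal_codiagonal sqS hn)), ⟨fun x y hxy => ?_⟩,
      fun i j => by rw [h₃, h₃ j], fun T t ht => ?_⟩
  · refine sq'.hom_ext hxy (Sigma.hom_ext _ _ (fun i => ?_))
    rw [← Category.assoc, ← Category.assoc, ← h₁ i]
    simp only [Category.assoc, hxy]
  · refine ⟨sq'.desc t (Sigma.desc (fun _ => (q ≫ g i₀) ≫ t)) (Sigma.hom_ext _ _ (fun i => ?_)),
      sq'.inl_desc _ _ _⟩
    rw [Sigma.ι_desc_assoc, Sigma.ι_map_assoc, Sigma.ι_desc]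
    apply sqS.hom_ext
    · rw [sqS.inl_desc_assoc, sqS.inl_desc_assoc, Category.id_comp]
    · rw [sqS.inr_desc_assoc, sqS.inr_desc_assoc, Category.id_comp, Category.assoc, Category.assoc,
        ht i i₀]

end Factorization

/-! ### The orthogonal factorization -/

section Factorization

variable {C : Type u} [Category.{v} C] {κ : Cardinal.{w}} [Fact κ.IsRegular]

instance locallySmall_factorisation [LocallySmall.{w} C] {X Y : C} (f : X ⟶ Y) :
    LocallySmall.{w} (Factorisation f) where
  hom_small d e := small_of_injective (f := fun φ : d ⟶ e => φ.h)
    (fun _ _ h => Factorisation.Hom.ext h)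

/-- The factorizations of `f` whose first morphism belongs to `Q`. -/
def factorisationsThrough (Q : MorphismProperty C) {X Y : C} (f : X ⟶ Y) :
    ObjectProperty (Factorisation f) :=
  fun F => Q F.ι

lemma essentiallySmall_factorisationsThrough_pushouts [LocallySmall.{w} C] [HasPushouts C]
    (N : MorphismProperty C) [MorphismProperty.IsSmall.{w} N] {X Y : C} (f : X ⟶ Y) :
    ObjectProperty.EssentiallySmall.{w} (factorisationsThrough N.pushouts f) where
  exists_small_le' := by
    let T := Σ (a : N.toSet) (p : a.1.left ⟶ X),
      { r : pushout p a.1.hom ⟶ Y // pushout.inl _ _ ≫ r = f }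
    have : Small.{w} T := inferInstance
    let F (t : T) : Factorisation f := ⟨_, pushout.inl t.2.1 t.1.1.hom, t.2.2.1, t.2.2.2⟩
    refine ⟨.ofObj F, inferInstance, fun G hG => ?_⟩
    obtain ⟨A, B, n, p, q, hn, sq⟩ := hG
    let e := sq.isoPushout
    let t : T := ⟨⟨Arrow.mk n, hn⟩, p, e.inv ≫ G.π,
      (sq.inl_isoPushout_inv_assoc G.π).trans G.ι_π⟩
    refine ⟨F t, ⟨t⟩, ⟨⟨⟨e.hom, sq.inl_isoPushout_hom, ?_⟩, ⟨e.inv, sq.inl_isoPushout_inv, rfl⟩,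
      Factorisation.Hom.ext e.hom_inv_id, Factorisation.Hom.ext e.inv_hom_id⟩⟩⟩
    exact e.hom_inv_id_assoc _

variable [IsCardinalLocallyPresentable C κ] {R : MorphismProperty C}

lemma essentiallySmall_factorisationsThrough {X Y : C} (f : X ⟶ Y) :
    ObjectProperty.EssentiallySmall.{w}
      (factorisationsThrough (presentableLeftOrthogonal κ R).pushouts f) := by
  obtain ⟨N, _, hN, hN'⟩ := exists_isSmall_le_pushouts.{w} (κ := κ)
    (W := presentableLeftOrthogonal κ R) inf_le_right
  have := essentiallySmall_factorisationsThrough_pushouts.{w} N f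
  exact .of_le (Q := factorisationsThrough N.pushouts f)
    (fun F hF => MorphismProperty.pushouts_le_iff.2 hN' _ hF)

instance isCardinalFiltered_factorisationsThrough {X Y : C} (f : X ⟶ Y) :
    IsCardinalFiltered
      (factorisationsThrough (presentableLeftOrthogonal κ R).pushouts f).FullSubcategory κ := by
  rw [isCardinalFiltered_iff]
  refine ⟨fun ι F hι => ?_, fun ι F G φ hι => ?_⟩
  · obtain ⟨Z, z, h, hz, hh, hZ⟩ := pushouts_presentableLeftOrthogonal_wideSpan hι
      (fun i => (F i).obj.ι) (fun i => (F i).property)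
    obtain ⟨s, hs, hs'⟩ := hZ f (fun i => (F i).obj.π) (fun i => (F i).obj.ι_π)
    exact ⟨⟨⟨Z, z, s, hs⟩, hz⟩, fun i => ⟨ObjectProperty.homMk ⟨h i, hh i, hs' i⟩⟩⟩
  · obtain hι' | ⟨⟨i₀⟩⟩ := isEmpty_or_nonempty ι
    -- For an empty family of morphisms `F ⟶ G` one still needs an upper bound of `F` and `G`.
    · obtain ⟨Z, z, h, hz, hh, hZ⟩ := pushouts_presentableLeftOrthogonal_wideSpan
        (ι := ULift Bool) (hasCardinalLT_of_finite _ _ (Cardinal.IsRegular.aleph0_le Fact.out))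
        (Y := fun b => bif b.down then F.obj.mid else G.obj.mid)
        (fun | ⟨true⟩ => F.obj.ι | ⟨false⟩ => G.obj.ι)
        (fun | ⟨true⟩ => F.property | ⟨false⟩ => G.property)
      obtain ⟨s, hs, hs'⟩ := hZ f (fun | ⟨true⟩ => F.obj.π | ⟨false⟩ => G.obj.π)
        (fun | ⟨true⟩ => F.obj.ι_π | ⟨false⟩ => G.obj.ι_π)
      exact ⟨⟨⟨Z, z, s, hs⟩, hz⟩, ObjectProperty.homMk ⟨h ⟨false⟩, hh ⟨false⟩, hs' ⟨false⟩⟩,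
        ObjectProperty.homMk ⟨h ⟨true⟩, hh ⟨true⟩, hs' ⟨true⟩⟩, fun i => isEmptyElim i⟩
    · have : Nonempty ι := ⟨i₀⟩
      obtain ⟨Z, h, hh, _, hφ, hZ⟩ := pushouts_presentableLeftOrthogonal_coeq hι F.property
        (fun i => (φ i).hom.h) (fun i j => by rw [(φ i).hom.ι_h, (φ j).hom.ι_h])
      obtain ⟨s, hs⟩ := hZ G.obj.π (fun i j => by rw [(φ i).hom.h_π, (φ j).hom.h_π])
      let H : (factorisationsThrough (presentableLeftOrthogonal κ R).pushouts f).FullSubcategory :=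
        ⟨⟨Z, G.obj.ι ≫ h, s, by rw [Category.assoc, hs, G.obj.ι_π]⟩,
          pushouts_presentableLeftOrthogonal_comp G.property hh⟩
      let a : G ⟶ H := ObjectProperty.homMk ⟨h, rfl, hs⟩
      exact ⟨H, a, φ i₀ ≫ a, fun i => ObjectProperty.hom_ext _
        (Factorisation.Hom.ext (hφ i i₀))⟩

/-- Every morphism factors as a `κ`-filtered colimit of pushouts of members of
`presentableLeftOrthogonal κ R`, followed by a morphism which is right orthogonal to them:
the first part is the colimit of all the factorizations through such pushouts. -/
theorem exists_factorization (R : MorphismProperty C) {X Y : C} (f : X ⟶ Y) :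
    ∃ (Z : C) (i : X ⟶ Z) (p : Z ⟶ Y), i ≫ p = f ∧
      filteredColimits κ (presentableLeftOrthogonal κ R).pushouts i ∧
      rightOrthogonal (presentableLeftOrthogonal κ R) p := by
  let P := factorisationsThrough (presentableLeftOrthogonal κ R).pushouts f
  have : ObjectProperty.EssentiallySmall.{w} P := essentiallySmall_factorisationsThrough f
  have : EssentiallySmall.{w} P.FullSubcategory := inferInstance
  let J := SmallModel.{w} P.FullSubcategory
  have : IsCardinalFiltered J κ := .of_equivalence κ (equivSmallModel.{w} P.FullSubcategory)
  have := isFiltered_of_isCardinalFiltered J κ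
  have : EssentiallySmall.{w} J := essentiallySmall_of_small_of_locallySmall J
  let Φ : J ⥤ P.FullSubcategory := (equivSmallModel.{w} P.FullSubcategory).inverse
  -- The index category `J` is a small model of the category of factorizations, so a morphism out of
  -- `Φ.obj j` is only up to isomorphism the image of a morphism of `J`.
  have hΦ (j : J) (G : P.FullSubcategory) (a : Φ.obj j ⟶ G) :
      ∃ (k : J) (φ : j ⟶ k) (b : G ⟶ Φ.obj k), a.hom.h ≫ b.hom.h = (Φ.map φ).hom.h := by
    refine ⟨Φ.objPreimage G, Φ.preimage (a ≫ (Φ.objObjPreimageIso G).inv),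
      (Φ.objObjPreimageIso G).inv, ?_⟩
    rw [Functor.map_preimage]
    rfl
  let D : J ⥤ C :=
    { obj j := (Φ.obj j).obj.mid
      map φ := (Φ.map φ).hom.h
      map_id j := by simp
      map_comp _ _ := by simp }
  let DX : J ⥤ Under X :=
    { obj j := Under.mk (Φ.obj j).obj.ι
      map φ := Under.homMk (Φ.map φ).hom.h (Φ.map φ).hom.ι_h
      map_id j := by ext; exact D.map_id j
      map_comp φ ψ := by ext; exact D.map_comp φ ψ }
  let x (j : J) : X ⟶ D.obj j := (Φ.obj j).obj.ι
  let y (j : J) : D.obj j ⟶ Y := (Φ.obj j).obj.π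
  have hxy (j) : x j ≫ y j = f := (Φ.obj j).obj.ι_π
  have hx {j k} (φ : j ⟶ k) : x j ≫ D.map φ = x k := (Φ.map φ).hom.ι_h
  have hy {j k} (φ : j ⟶ k) : D.map φ ≫ y k = y j := (Φ.map φ).hom.h_π
  obtain ⟨p, hp⟩ : ∃ p : colimit D ⟶ Y, ∀ j, colimit.ι D j ≫ p = y j :=
    ⟨colimit.desc D { pt := Y, ι := { app := y, naturality j k φ := by simp [hy] } },
      fun j => colimit.ι_desc _ _⟩
  obtain ⟨i, hi⟩ : ∃ i : X ⟶ colimit D, ∀ j, x j ≫ colimit.ι D j = i := by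
    obtain ⟨j₀⟩ := IsFiltered.nonempty (C := J)
    refine ⟨x j₀ ≫ colimit.ι D j₀, fun j => ?_⟩
    rw [← colimit.w D (IsFiltered.leftToMax j j₀), ← colimit.w D (IsFiltered.rightToMax j j₀),
      reassoc_of% (hx (IsFiltered.leftToMax j j₀)), reassoc_of% (hx (IsFiltered.rightToMax j j₀))]
  -- A pushout attached to a stage of the diagram, over `Y`, is absorbed by the colimit.
  have hext (j : J) {E : C} (g : D.obj j ⟶ E)
      (hg : (presentableLeftOrthogonal κ R).pushouts g) (r : E ⟶ Y) (hr : g ≫ r = y j) :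
      ∃ s : E ⟶ colimit D, g ≫ s = colimit.ι D j ∧ s ≫ p = r := by
    let G : P.FullSubcategory := ⟨⟨E, x j ≫ g, r, by rw [Category.assoc, hr, hxy]⟩,
      pushouts_presentableLeftOrthogonal_comp (Φ.obj j).property hg⟩
    obtain ⟨k, φ, b, hb⟩ := hΦ j G (ObjectProperty.homMk ⟨g, rfl, hr⟩)
    obtain ⟨b', hb', hb''⟩ : ∃ b' : E ⟶ D.obj k, g ≫ b' = D.map φ ∧ b' ≫ y k = r :=
      ⟨b.hom.h, hb, b.hom.h_π⟩
    exact ⟨b' ≫ colimit.ι D k, by rw [reassoc_of% hb', colimit.w],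
      by rw [Category.assoc, hp, hb'']⟩
  refine ⟨colimit D, i, p, ?_, ⟨J, _, inferInstance, DX, colimit.cocone D, colimit.isColimit D,
    Iso.refl _, fun j => (Φ.obj j).property, fun j => ?_⟩, fun A B n hn a b hab => ?_⟩
  · obtain ⟨j₀⟩ := IsFiltered.nonempty (C := J)
    rw [← hi j₀, Category.assoc, hp, hxy]
  · exact (congrArg (x j ≫ ·) (Category.comp_id (colimit.ι D j))).trans (hi j)
  have := hn.2.1
  have := hn.2.2
  refine existsUnique_of_exists_of_unique ?_ ?_
  -- A diagonal is obtained by attaching the pushout of `n` to a stage through which `a` factors.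
  · obtain ⟨j, a', rfl⟩ := IsCardinalPresentable.exists_hom_of_isColimit κ (colimit.isColimit D) a
    have sq := IsPushout.of_hasPushout a' n
    have hab' : a' ≫ y j = n ≫ b := by
      rw [← hab, ← hp]
      exact (Category.assoc _ _ _).symm
    obtain ⟨s, hs, hs'⟩ := hext j _ (MorphismProperty.pushouts_mk _ sq hn)
      (sq.desc (y j) b hab') (sq.inl_desc _ _ _)
    refine ⟨pushout.inr a' n ≫ s, ?_, ?_⟩
    · rw [← sq.w_assoc, hs]
      rfl
    · rw [Category.assoc, hs', sq.inr_desc]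
  -- Two diagonals become equal by attaching the pushout of the codiagonal of `n`.
  · rintro d₁ d₂ ⟨h₁, h₁'⟩ ⟨h₂, h₂'⟩
    obtain ⟨j₁, d₁, rfl⟩ := IsCardinalPresentable.exists_hom_of_isColimit κ (colimit.isColimit D) d₁
    obtain ⟨j₂, d₂, rfl⟩ := IsCardinalPresentable.exists_hom_of_isColimit κ (colimit.isColimit D) d₂
    obtain ⟨k, u, v, h⟩ := IsCardinalPresentable.exists_eq_of_isColimit κ (colimit.isColimit D)
      (n ≫ d₁) (n ≫ d₂) (by rw [Category.assoc, Category.assoc, h₁, h₂])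
    have sqS := IsPushout.of_hasPushout n n
    obtain ⟨e₁, he₁⟩ : ∃ e₁, e₁ = d₁ ≫ D.map u := ⟨_, rfl⟩
    obtain ⟨e₂, he₂⟩ : ∃ e₂, e₂ = d₂ ≫ D.map v := ⟨_, rfl⟩
    have hd₁ : d₁ ≫ colimit.ι D j₁ = e₁ ≫ colimit.ι D k := by
      rw [he₁, Category.assoc, colimit.w]
    have hd₂ : d₂ ≫ colimit.ι D j₂ = e₂ ≫ colimit.ι D k := by
      rw [he₂, Category.assoc, colimit.w]
    refine hd₁.trans (Eq.trans ?_ hd₂.symm)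
    replace h₁' : e₁ ≫ y k = b := by
      rw [← h₁', ← hp, ← Category.assoc, ← hd₁]; rfl
    replace h₂' : e₂ ≫ y k = b := by
      rw [← h₂', ← hp, ← Category.assoc, ← hd₂]; rfl
    rw [Category.assoc, Category.assoc, ← he₁, ← he₂] at h
    have sq := IsPushout.of_hasPushout (sqS.desc e₁ e₂ h) (sqS.desc (𝟙 B) (𝟙 B) rfl)
    obtain ⟨s, hs, -⟩ := hext k _ (MorphismProperty.pushouts_mk _ sq
      (presentableLeftOrthogonal_codiagonal sqS hn)) (sq.desc (y k) b (sqS.hom_ext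
        (by rw [sqS.inl_desc_assoc, sqS.inl_desc_assoc, Category.id_comp, h₁'])
        (by rw [sqS.inr_desc_assoc, sqS.inr_desc_assoc, Category.id_comp, h₂'])))
        (sq.inl_desc _ _ _)
    have hw₁ := pushout.inl n n ≫= sq.w
    have hw₂ := pushout.inr n n ≫= sq.w
    rw [sqS.inl_desc_assoc, sqS.inl_desc_assoc, Category.id_comp] at hw₁
    rw [sqS.inr_desc_assoc, sqS.inr_desc_assoc, Category.id_comp] at hw₂
    rw [← hs, reassoc_of% hw₁, reassoc_of% hw₂]

/-- Applied to `⊥_ C ⟶ G` with `G` in the strong generator of `κ`-presentable objects, the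
orthogonality says that `p` induces bijections on the morphisms out of `G`. -/
lemma isIso_of_rightOrthogonal {Y Z : C} {p : Z ⟶ Y}
    (hp : rightOrthogonal (betweenPresentables C κ) p) : IsIso p := by
  have hp' (G : C) (hG : IsCardinalPresentable G κ) (b : G ⟶ Y) : ∃! d : G ⟶ Z, d ≫ p = b := by
    have := hp (initial.to G) ⟨isCardinalPresentable_initial, hG⟩ (initial.to Z) b
      (Subsingleton.elim _ _)
    simpa [Subsingleton.elim (initial.to G ≫ _) (initial.to Z)] using this
  have hS := (isCardinalFilteredGenerator_isCardinalPresentable C κ).isStrongGenerator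
  have : Mono p := ⟨fun a b h => hS.isSeparating _ _ (fun G hG g =>
    (hp' G hG (g ≫ a ≫ p)).unique (by simp) (by simp [h]))⟩
  exact hS.isIso_of_mono p (fun G hG b => (hp' G hG b).exists)

/-- A `κ`-presentable morphism is a pushout of a morphism between `κ`-presentable objects.
By the factorization it is a `κ`-filtered colimit, under its source, of such pushouts, hence
a retract of one of them, `g`, by presentability. The idempotent of the retraction is split
by coequalizing it with the identity, which amounts to composing `g` with another pushout. -/
theorem presentableMorphisms_le_pushouts :
    presentableMorphisms C κ ≤ (betweenPresentables C κ).pushouts := by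
  intro A B m hm
  have : IsCardinalPresentable (Under.mk m) κ := hm
  -- Every morphism is left orthogonal to the isomorphisms.
  let R := MorphismProperty.isomorphisms C
  have hR : presentableLeftOrthogonal κ R = betweenPresentables C κ := by
    refine le_antisymm inf_le_right (le_inf (fun X Y n _ U V i (hi : IsIso i) f g h => ?_) le_rfl)
    exact ⟨g ≫ inv i, ⟨by rw [← Category.assoc, ← h]; simp, by simp⟩, fun d hd => by simp [← hd.2]⟩
  obtain ⟨Z, i, p, hip, hi, hp⟩ := exists_factorization (κ := κ) R m
  rw [hR] at hp
  have := isIso_of_rightOrthogonal hp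
  obtain ⟨J, _, _, D, ι, hD, hι, hw, hext, hdesc⟩ := hi.exists_diagram
  have : EssentiallySmall.{w} J := essentiallySmall_of_small_of_locallySmall J
  let c : Cocone D :=
    { pt := Under.mk i
      ι :=
        { app j := Under.homMk (ι j) (hι j)
          naturality j k φ := by ext; simp [hw] } }
  have := IsCardinalFiltered.nonempty J κ
  have hd (s : Cocone D) : ∃ d : Z ⟶ s.pt.right, ∀ j, ι j ≫ d = (s.ι.app j).right := by
    let l (j : J) : (D.obj j).right ⟶ s.pt.right := (s.ι.app j).right
    exact hdesc l (fun j k φ => congrArg (fun x => x.right) (s.w φ))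
  choose d hd using hd
  have hc : IsColimit c :=
    { desc s := Under.homMk (d s) (by
        obtain ⟨j⟩ := IsCardinalFiltered.nonempty J κ
        change i ≫ d s = s.pt.hom
        rw [← hι j, Category.assoc, hd, Under.w]
        rfl)
      fac s j := by ext; exact hd s j
      uniq s m hm := by
        ext
        exact hext _ _ (fun j => (congrArg (fun x => x.right) (hm j)).trans (hd s j).symm) }
  let e : Under.mk m ⟶ Under.mk i := Under.homMk (inv p) (by simp [← hip])
  obtain ⟨j, s, hs⟩ := IsCardinalPresentable.exists_hom_of_isColimit κ hc e
  obtain ⟨g, hg⟩ : ∃ g : A ⟶ (D.obj j).right, g = (D.obj j).hom := ⟨_, rfl⟩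
  obtain ⟨r, hr⟩ : ∃ r : (D.obj j).right ⟶ B, r = ι j ≫ p := ⟨_, rfl⟩
  obtain ⟨s', hs₁, hs₂⟩ : ∃ s' : B ⟶ (D.obj j).right, m ≫ s' = g ∧ s' ≫ r = 𝟙 B := by
    refine ⟨s.right, hg ▸ Under.w s, ?_⟩
    have : s.right ≫ ι j = inv p := congrArg (fun x => x.right) hs
    rw [hr, reassoc_of% this, IsIso.inv_hom_id]
    rfl
  have hg' : (presentableLeftOrthogonal κ R).pushouts g := hg ▸ hD j
  have hgr : g ≫ r = m := by rw [hg, hr, reassoc_of% (hι j), hip]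
  have hge : g ≫ r ≫ s' = g := by rw [reassoc_of% hgr, hs₁]
  obtain ⟨T, h, hh, _, hh', hT⟩ := pushouts_presentableLeftOrthogonal_coeq (ι := ULift.{w} Bool)
    (hasCardinalLT_of_finite _ _ (Cardinal.IsRegular.aleph0_le Fact.out)) hg'
    (fun b => bif b.down then 𝟙 _ else r ≫ s') (by
      rintro ⟨_ | _⟩ ⟨_ | _⟩ <;> simp [hge])
  obtain ⟨t, ht⟩ := hT r (by rintro ⟨_ | _⟩ ⟨_ | _⟩ <;> simp [hs₂])
  have hh'' : r ≫ s' ≫ h = h := by simpa using hh' ⟨false⟩ ⟨true⟩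
  have hcomp := pushouts_presentableLeftOrthogonal_comp hg' hh
  rw [hR] at hcomp
  let e' : B ≅ T :=
    { hom := s' ≫ h
      inv := t
      hom_inv_id := by rw [Category.assoc, ht, hs₂]
      inv_hom_id := by rw [← cancel_epi h, reassoc_of% ht, hh'', Category.comp_id] }
  refine (MorphismProperty.arrow_mk_iso_iff _ (Arrow.isoMk (Iso.refl A) e' ?_)).2 hcomp
  simp [e', reassoc_of% hs₁]

end Factorization

/-! ### Transfinite compositions of transfinite compositions -/

section Lexicographic

variable {C : Type u} [Category.{v} C]

/-- If a functor `H` with a colimit is cofinal in the restriction of `G` to the elements below `m`,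
and its colimit is `G.obj m`, then `G` is continuous at `m`. -/
lemma nonempty_isColimit_principalSegIio {Λ : Type*} [PartialOrder Λ] (G : Λ ⥤ C) (m : Λ)
    {K : Type*} [Preorder K] {φ : K → Λ} (hφ : Monotone φ) (hφm : ∀ k, φ k < m)
    (hcof : ∀ a, a < m → ∃ k, a ≤ φ k) {H : K ⥤ C} {c : Cocone H} (hc : IsColimit c)
    (e : ∀ k, H.obj k ≅ G.obj (φ k))
    (he : ∀ {k l : K} (h : k ≤ l), H.map (homOfLE h) ≫ (e l).hom =
      (e k).hom ≫ G.map (homOfLE (hφ h)))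
    (e' : c.pt ≅ G.obj m)
    (he' : ∀ k, c.ι.app k ≫ e'.hom = (e k).hom ≫ G.map (homOfLE (hφm k).le)) :
    Nonempty (IsColimit ((Set.principalSegIio m).cocone G)) := by
  refine ⟨IsColimit.ofExistsUnique (fun s => ?_)⟩
  let t (a : Λ) (ha : a < m) : G.obj a ⟶ s.pt := s.ι.app ⟨a, ha⟩
  have ht {a b : Λ} (hab : a ≤ b) (hb : b < m) :
      G.map (homOfLE hab) ≫ t b hb = t a (hab.trans_lt hb) :=
    s.w (homOfLE hab : (⟨a, hab.trans_lt hb⟩ : Set.Iio m) ⟶ ⟨b, hb⟩)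
  obtain ⟨d, hd⟩ : ∃ d : c.pt ⟶ s.pt, ∀ k, c.ι.app k ≫ d = (e k).hom ≫ t _ (hφm k) :=
    ⟨hc.desc
      { pt := s.pt
        ι :=
          { app k := (e k).hom ≫ t _ (hφm k)
            naturality k l f := by
              rw [← Category.assoc]
              refine (congrArg (· ≫ t _ (hφm l)) (he (leOfHom f))).trans ?_
              rw [Category.assoc, ht]
              exact (Category.comp_id _).symm } },
      fun k => hc.fac _ k⟩
  refine ⟨e'.inv ≫ d, ?_, fun (d' : G.obj m ⟶ s.pt) hd' => ?_⟩
  · rintro ⟨a, ha⟩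
    obtain ⟨k, hk⟩ := hcof a ha
    change G.map (homOfLE ha.le) ≫ e'.inv ≫ d = t a ha
    rw [← ht hk (hφm k), ← homOfLE_comp hk (hφm k).le, G.map_comp, Category.assoc]
    congr 1
    rw [← cancel_epi (e k).hom, ← Category.assoc, ← he' k, ← hd k]
    exact (Category.assoc _ _ _).trans (congrArg _ (e'.hom_inv_id_assoc d))
  · refine (e'.eq_inv_comp (g := d')).2 (hc.hom_ext (fun k => ?_))
    rw [hd]
    exact (Category.assoc _ _ _).symm.trans ((congrArg (· ≫ d') (he' k)).trans
      ((Category.assoc _ _ _).trans (congrArg ((e k).hom ≫ ·) (hd' ⟨φ k, hφm k⟩))))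

namespace LexComposition

section

variable {J : Type*} [LinearOrder J] {K : J → Type*} [∀ j, LinearOrder (K j)]

lemma le_iff_of_eq {j : J} {k k' : K j} :
    toLex (⟨j, k⟩ : Σ j, K j) ≤ toLex ⟨j, k'⟩ ↔ k ≤ k' :=
  ⟨fun hab => by
    obtain h | ⟨_, h⟩ := Sigma.Lex.le_def.1 hab
    exacts [(lt_irrefl _ h).elim, h], fun hk => Sigma.Lex.le_def.2 (Or.inr ⟨rfl, hk⟩)⟩

lemma lt_iff_of_eq {j : J} {k k' : K j} :
    toLex (⟨j, k⟩ : Σ j, K j) < toLex ⟨j, k'⟩ ↔ k < k' := by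
  rw [← not_le, ← not_le, le_iff_of_eq]

lemma lt_of_fst_lt {j j' : J} (hj : j < j') (k : K j) (k' : K j') :
    toLex (⟨j, k⟩ : Σ j, K j) < toLex ⟨j', k'⟩ :=
  Sigma.Lex.lt_def.2 (Or.inl hj)

lemma fst_le {j j' : J} {k : K j} {k' : K j'}
    (hab : toLex (⟨j, k⟩ : Σ j, K j) ≤ toLex ⟨j', k'⟩) : j ≤ j' := by
  obtain h | ⟨h, -⟩ := Sigma.Lex.le_def.1 hab
  exacts [h.le, h.le]

lemma lt_mk_bot_iff [∀ j, OrderBot (K j)] {a : Σₗ j, K j} {j : J} :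
    a < toLex (⟨j, ⊥⟩ : Σ j, K j) ↔ (ofLex a).1 < j := by
  refine ⟨fun ha => ?_, fun ha => Sigma.Lex.lt_def.2 (Or.inl ha)⟩
  obtain ⟨i, k⟩ := a
  obtain rfl | hi := (fst_le ha.le).eq_or_lt
  · exact (not_lt_bot (lt_iff_of_eq.1 ha)).elim
  · exact hi

lemma covBy_of_eq {j : J} {k k' : K j} (hk : k ⋖ k') :
    (toLex ⟨j, k⟩ : Σₗ j, K j) ⋖ toLex ⟨j, k'⟩ := by
  refine ⟨lt_iff_of_eq.2 hk.1, ?_⟩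
  rintro ⟨i, l⟩ h₁ h₂
  obtain rfl := le_antisymm (fst_le h₁.le) (fst_le h₂.le)
  exact hk.2 (lt_iff_of_eq.1 h₁) (lt_iff_of_eq.1 h₂)

end

variable {W : MorphismProperty C} {J : Type w} [LinearOrder J] [SuccOrder J] {F : J ⥤ C}
  {K : J → Type w} [∀ j, LinearOrder (K j)] [∀ j, SuccOrder (K j)] [∀ j, OrderBot (K j)]
  [∀ j, WellFoundedLT (K j)]
  (h : ∀ j, W.TransfiniteCompositionOfShape (K j) (F.map (homOfLE (Order.le_succ j))))

/-- The inclusion into the colimit of the `j`-th composition. -/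
def out {j : J} (k : K j) : (h j).F.obj k ⟶ F.obj (Order.succ j) := (h j).incl.app k

/-- The inclusion of the source of the `j`-th composition. -/
def into {j : J} (k : K j) : F.obj j ⟶ (h j).F.obj k :=
  (h j).isoBot.inv ≫ (h j).F.map (homOfLE bot_le)

lemma map_out {j : J} {k l : K j} (hkl : k ≤ l) :
    (h j).F.map (homOfLE hkl) ≫ out h l = out h k :=
  ((h j).incl.naturality (homOfLE hkl)).trans (Category.comp_id _)

lemma into_map {j : J} {k l : K j} (hkl : k ≤ l) :
    into h k ≫ (h j).F.map (homOfLE hkl) = into h l := by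
  rw [into, Category.assoc, ← Functor.map_comp, homOfLE_comp, into]

lemma into_bot (j : J) : into h (⊥ : K j) = (h j).isoBot.inv := by
  rw [into]
  exact (congrArg _ ((h j).F.map_id ⊥)).trans (Category.comp_id _)

lemma into_out {j : J} (k : K j) : into h k ≫ out h k = F.map (homOfLE (Order.le_succ j)) := by
  rw [into, Category.assoc, map_out]
  exact (h j).fac

open scoped Classical in
/-- The transition morphisms of the concatenation of the compositions, which has the object
`(h j).F.obj k` in position `⟨j, k⟩`. -/
noncomputable def map {j j' : J} (k : K j) (k' : K j')
    (hab : toLex (⟨j, k⟩ : Σ j, K j) ≤ toLex ⟨j', k'⟩) : (h j).F.obj k ⟶ (h j').F.obj k' :=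
  if e : j = j' then by
    subst e
    exact (h j).F.map (homOfLE (le_iff_of_eq.1 hab))
  else out h k ≫ F.map (homOfLE (Order.succ_le_of_lt (lt_of_le_of_ne (fst_le hab) e))) ≫ into h k'

lemma map_of_eq {j : J} {k k' : K j} (hk : k ≤ k') :
    map h k k' (le_iff_of_eq.2 hk) = (h j).F.map (homOfLE hk) := by
  simp [map]

lemma map_of_lt {j j' : J} (hj : j < j') (k : K j) (k' : K j') :
    map h k k' (lt_of_fst_lt hj k k').le =
      out h k ≫ F.map (homOfLE (Order.succ_le_of_lt hj)) ≫ into h k' := by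
  simp [map, hj.ne]

/-- The concatenation of the compositions, indexed by the lexicographic order. -/
noncomputable def functor : (Σₗ j, K j) ⥤ C where
  obj a := (h (ofLex a).1).F.obj (ofLex a).2
  map {a b} f := map h (ofLex a).2 (ofLex b).2 (leOfHom f)
  map_id a := (map_of_eq h le_rfl).trans ((h _).F.map_id _)
  map_comp {a b c} f g := by
    obtain ⟨j₁, k₁⟩ := a
    obtain ⟨j₂, k₂⟩ := b
    obtain ⟨j₃, k₃⟩ := c
    change map h k₁ k₃ _ = map h k₁ k₂ _ ≫ map h k₂ k₃ _
    obtain rfl | h₁ := (fst_le (leOfHom f)).eq_or_lt <;>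
      obtain rfl | h₂ := (fst_le (leOfHom g)).eq_or_lt
    · have hf := le_iff_of_eq.1 (leOfHom f)
      have hg := le_iff_of_eq.1 (leOfHom g)
      rw [map_of_eq h (hf.trans hg), map_of_eq h hf, map_of_eq h hg, ← Functor.map_comp,
        homOfLE_comp]
    · have hf := le_iff_of_eq.1 (leOfHom f)
      rw [map_of_lt h h₂, map_of_eq h hf, map_of_lt h h₂, reassoc_of% @map_out]
    · have hg := le_iff_of_eq.1 (leOfHom g)
      rw [map_of_lt h h₁, map_of_lt h h₁, map_of_eq h hg, Category.assoc, Category.assoc, into_map]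
    · rw [map_of_lt h (h₁.trans h₂), map_of_lt h h₁, map_of_lt h h₂]
      simp only [Category.assoc]
      rw [reassoc_of% @into_out, ← F.map_comp_assoc, ← F.map_comp_assoc]
      rfl

/-- The morphisms of the concatenation of the compositions to the colimit of `F`. -/
noncomputable def toPt (c : Cocone F) {j : J} (k : K j) : (h j).F.obj k ⟶ c.pt :=
  out h k ≫ c.ι.app (Order.succ j)

lemma into_toPt (c : Cocone F) {j : J} (k : K j) : into h k ≫ toPt h c k = c.ι.app j := by
  rw [toPt, reassoc_of% @into_out]
  exact c.w _

lemma map_toPt (c : Cocone F) {j j' : J} (k : K j) (k' : K j')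
    (hab : toLex (⟨j, k⟩ : Σ j, K j) ≤ toLex ⟨j', k'⟩) :
    map h k k' hab ≫ toPt h c k' = toPt h c k := by
  obtain rfl | hj := (fst_le hab).eq_or_lt
  · rw [map_of_eq h (le_iff_of_eq.1 hab), toPt, reassoc_of% @map_out, toPt]
  · rw [map_of_lt h hj, Category.assoc, Category.assoc, into_toPt]
    exact congrArg _ (c.w _)

/-- The cocone of the concatenation of the compositions given by a cocone of `F`. -/
noncomputable def cocone (c : Cocone F) : Cocone (functor h) where
  pt := c.pt
  ι :=
    { app a := toPt h c (ofLex a).2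
      naturality a b f :=
        (map_toPt h c (ofLex a).2 (ofLex b).2 (leOfHom f)).trans (Category.comp_id _).symm }

/-- The concatenation of the compositions has the colimit of `F` as its colimit. -/
noncomputable def isColimitCocone [NoMaxOrder J] {c : Cocone F} (hc : IsColimit c) :
    IsColimit (cocone h c) := by
  refine IsColimit.ofExistsUnique (fun s => ?_)
  let t {j : J} (k : K j) : (h j).F.obj k ⟶ s.pt := s.ι.app (toLex ⟨j, k⟩)
  have ht {j j' : J} (k : K j) (k' : K j') (hab) : map h k k' hab ≫ t k' = t k := by
    have f : (toLex ⟨j, k⟩ : Σₗ j, K j) ⟶ toLex ⟨j', k'⟩ := homOfLE hab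
    exact s.w f
  have ht' {j : J} (k : K j) : into h k ≫ t k = into h ⊥ ≫ t (⊥ : K j) := by
    rw [← ht ⊥ k (le_iff_of_eq.2 bot_le), map_of_eq h bot_le, reassoc_of% @into_map]
  have hto {j j' : J} (hj : j < j') (k : K j) : out h k ≫
      F.map (homOfLE (Order.succ_le_of_lt hj)) ≫ into h ⊥ ≫ t (⊥ : K j') = t k := by
    rw [← ht k (⊥ : K j') (lt_of_fst_lt hj _ _).le, map_of_lt h hj]
    simp only [Category.assoc]
  have hF {j j' : J} (hj : j ≤ j') :
      F.map (homOfLE hj) ≫ into h ⊥ ≫ t (⊥ : K j') = into h ⊥ ≫ t (⊥ : K j) := by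
    obtain rfl | hj := hj.eq_or_lt
    · exact (congrArg (· ≫ _) (F.map_id j)).trans (Category.id_comp _)
    · rw [← hto hj (⊥ : K j), reassoc_of% @into_out, ← F.map_comp_assoc]
      rfl
  obtain ⟨d, hd⟩ : ∃ d : c.pt ⟶ s.pt, ∀ j, c.ι.app j ≫ d = into h ⊥ ≫ t (⊥ : K j) :=
    ⟨hc.desc
      { pt := s.pt
        ι :=
          { app j := into h ⊥ ≫ t (⊥ : K j)
            naturality j j' f := (hF (leOfHom f)).trans (Category.comp_id _).symm } },
      fun j => hc.fac _ j⟩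
  refine ⟨d, ?_, fun (d' : c.pt ⟶ s.pt) hd' => hc.hom_ext (fun j => ?_)⟩
  · rintro ⟨j, k⟩
    change toPt h c k ≫ d = t k
    rw [toPt, Category.assoc]
    refine (congrArg (out h k ≫ ·) (hd _)).trans ?_
    refine Eq.trans ?_ (hto (Order.lt_succ j) k)
    exact congrArg (out h k ≫ ·) ((Category.id_comp _).symm.trans
      (congrArg (· ≫ _) (F.map_id _).symm))
  · rw [hd, ← into_toPt h c (⊥ : K j), Category.assoc]
    exact congrArg (into h (⊥ : K j) ≫ ·) (hd' (toLex ⟨j, ⊥⟩))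

lemma into_bot_map {j j' : J} (hj : j ≤ j')
    (hab : toLex (⟨j, ⊥⟩ : Σ j, K j) ≤ toLex ⟨j', ⊥⟩) :
    F.map (homOfLE hj) ≫ into h ⊥ = into h ⊥ ≫ map h ⊥ ⊥ hab := by
  obtain rfl | hj := hj.eq_or_lt
  · rw [map_of_eq h le_rfl, into_map]
    exact (congrArg (· ≫ _) (F.map_id j)).trans (Category.id_comp _)
  · rw [map_of_lt h hj, reassoc_of% @into_out, ← F.map_comp_assoc]
    rfl

lemma map_succ_bot [NoMaxOrder J] {j : J} (k : K j)
    (hab : toLex (⟨j, k⟩ : Σ j, K j) ≤ toLex ⟨Order.succ j, ⊥⟩) :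
    map h k ⊥ hab = out h k ≫ (h (Order.succ j)).isoBot.inv := by
  rw [map_of_lt h (Order.lt_succ j), ← into_bot]
  exact congrArg (out h k ≫ ·) ((congrArg (· ≫ _) (F.map_id _)).trans (Category.id_comp _))

/-- There are three kinds of limit positions `⟨j, k⟩`: if `k ≠ ⊥`, then `k` is a limit in `K j`; if
`k = ⊥`, then either `j` is a limit in `J`, or `j` is the successor of some `i`, and the object
there is the colimit of the `i`-th composition. -/
lemma isWellOrderContinuous_functor [NoMaxOrder J] [F.IsWellOrderContinuous] :
    (functor h).IsWellOrderContinuous where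
  nonempty_isColimit := by
    rintro ⟨j, k⟩ hm
    obtain rfl | hk := eq_or_ne k ⊥
    · by_cases hj : Order.IsSuccLimit j
      · refine nonempty_isColimit_principalSegIio (functor h) (toLex ⟨j, ⊥⟩)
          (φ := fun i : Set.Iio j => toLex ⟨i.1, ⊥⟩) ?_ (fun i => lt_of_fst_lt i.2 _ _) ?_
          (F.isColimitOfIsWellOrderContinuous j hj) (fun i => (h i.1).isoBot.symm) ?_
          (h j).isoBot.symm ?_
        · intro i i' hi
          obtain hi | hi := hi.eq_or_lt
          · rw [hi]
          · exact (lt_of_fst_lt (show i.1 < i'.1 from hi) _ _).le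
        · intro a ha
          exact ⟨⟨_, hj.succ_lt (lt_mk_bot_iff.1 ha)⟩, (lt_of_fst_lt (Order.lt_succ _) _ _).le⟩
        · intro i i' hi
          have := into_bot_map h (show i.1 ≤ i'.1 from hi)
          rw [into_bot, into_bot] at this
          exact this _
        · intro i
          have := into_bot_map h (show i.1 ≤ j from i.2.le)
          rw [into_bot, into_bot] at this
          exact this _
      · obtain ⟨j, rfl⟩ : ∃ i, j = Order.succ i := by
          rw [Order.not_isSuccLimit_iff] at hj
          obtain hj | hj := hj
          · refine (hm.1 ?_).elim
            intro a ha
            obtain ha | ha := ha.eq_or_lt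
            · exact ha.ge
            · exact (hj.not_lt (lt_mk_bot_iff.1 ha)).elim
          · obtain ⟨i, hi⟩ := Order.not_isSuccPrelimit_iff.1 hj
            exact ⟨i, hi.succ_eq.symm⟩
        refine nonempty_isColimit_principalSegIio (functor h) (toLex ⟨Order.succ j, ⊥⟩)
          (φ := fun k : K j => toLex ⟨j, k⟩) (fun k k' hk => le_iff_of_eq.2 hk)
          (fun k => lt_of_fst_lt (Order.lt_succ j) _ _) ?_
          (h j).isColimit (fun k => Iso.refl _) ?_ (h (Order.succ j)).isoBot.symm ?_
        · rintro ⟨i, l⟩ ha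
          obtain rfl | hi := (Order.lt_succ_iff.1 (lt_mk_bot_iff.1 ha)).eq_or_lt
          · exact ⟨l, le_rfl⟩
          · exact ⟨⊥, (lt_of_fst_lt hi _ _).le⟩
        · intro k k' hk
          exact (Category.comp_id _).trans ((map_of_eq h hk).symm.trans (Category.id_comp _).symm)
        · intro k
          exact (map_succ_bot h k _).symm.trans (Category.id_comp _).symm
    · have hk' : Order.IsSuccLimit k := by
        refine ⟨fun hk' => hk hk'.eq_bot, fun l hl => hm.2 _ (covBy_of_eq hl)⟩
      refine nonempty_isColimit_principalSegIio (functor h) (toLex ⟨j, k⟩)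
        (φ := fun l : Set.Iio k => toLex ⟨j, l.1⟩) (fun l l' hl => le_iff_of_eq.2 hl)
        (fun l => lt_iff_of_eq.2 l.2) ?_
        ((h j).F.isColimitOfIsWellOrderContinuous k hk') (fun l => Iso.refl _) ?_ (Iso.refl _) ?_
      · rintro ⟨i, l⟩ ha
        obtain rfl | hi := (fst_le ha.le).eq_or_lt
        · exact ⟨⟨l, lt_iff_of_eq.1 ha⟩, le_rfl⟩
        · exact ⟨⟨⊥, bot_lt_iff_ne_bot.2 hk⟩, (lt_of_fst_lt hi _ _).le⟩
      · intro l l' hl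
        exact (Category.comp_id _).trans
          ((map_of_eq h (show l.1 ≤ l'.1 from hl)).symm.trans (Category.id_comp _).symm)
      · intro l
        exact (Category.comp_id _).trans
          ((map_of_eq h (show l.1 ≤ k from l.2.le)).symm.trans (Category.id_comp _).symm)

lemma isIso_out_of_isMax {j : J} {k : K j} (hk : IsMax k) : IsIso (out h k) :=
  have hk' : IsTerminal k := IsTerminal.ofUniqueHom (fun l => homOfLE (hk.isTop l))
    (fun _ _ => Subsingleton.elim _ _)
  (h j).isColimit.isIso_ι_app_of_isTerminal k hk'

/-- A step of the concatenation is a step of one of the compositions, unless it leads from the last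
object of one composition to the first object of the next one, in which case it is invertible. -/
lemma map_mem [NoMaxOrder J] (hW : MorphismProperty.isomorphisms C ≤ W) {a b : Σₗ j, K j}
    (hab : a ⋖ b) : W ((functor h).map (homOfLE hab.le)) := by
  obtain ⟨j, k⟩ := a
  obtain ⟨j', k'⟩ := b
  change W (map h k k' hab.le)
  obtain rfl | hj := (fst_le hab.le).eq_or_lt
  · have hk : k ⋖ k' := ⟨lt_iff_of_eq.1 hab.1, fun l h₁ h₂ =>
      hab.2 (lt_iff_of_eq.2 h₁) (lt_iff_of_eq.2 h₂)⟩
    obtain rfl := hk.succ_eq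
    rw [map_of_eq h hk.le]
    exact (h j).map_mem k (fun hk' => hk'.not_lt hk.lt)
  · have hk : IsMax k := by
      by_contra hk
      exact hab.2 (lt_iff_of_eq.2 (Order.lt_succ_of_not_isMax hk))
        (lt_of_fst_lt hj (Order.succ k) k')
    have hlt := lt_of_fst_lt (Order.lt_succ j) k (⊥ : K (Order.succ j))
    obtain rfl : Order.succ j = j' := by
      refine (Order.succ_le_of_lt hj).eq_of_not_lt (fun hj' => ?_)
      exact hab.2 hlt (lt_of_fst_lt hj' ⊥ k')
    obtain rfl : k' = ⊥ := by
      by_contra hk'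
      exact hab.2 hlt (lt_iff_of_eq.2 (bot_lt_iff_ne_bot.2 hk'))
    change W (map h k ⊥ hlt.le)
    rw [map_succ_bot]
    have := isIso_out_of_isMax h hk
    exact hW _ (MorphismProperty.isomorphisms.infer_property _)

instance wellFoundedLT [WellFoundedLT J] : WellFoundedLT (Σₗ j, K j) where
  wf := by
    refine ⟨fun ⟨j, k⟩ => ?_⟩
    induction j using WellFoundedLT.induction with | ind j ihj
    induction k using WellFoundedLT.induction with | ind k ihk
    refine ⟨_, ?_⟩
    rintro ⟨i, l⟩ ha
    obtain rfl | hi := (fst_le ha.le).eq_or_lt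
    · exact ihk l (lt_iff_of_eq.1 ha)
    · exact ihj i hi l

end LexComposition

/-- If `W` contains the isomorphisms, transfinite compositions of transfinite compositions of
members of `W` are transfinite compositions of members of `W`. -/
theorem transfiniteCompositions_of_transfiniteCompositionOfShape {W : MorphismProperty C}
    (hW : MorphismProperty.isomorphisms C ≤ W) {J : Type w} [LinearOrder J] [SuccOrder J]
    [OrderBot J] [WellFoundedLT J] [NoMaxOrder J] {X Y : C} {f : X ⟶ Y}
    (hf : (MorphismProperty.transfiniteCompositions.{w} W).TransfiniteCompositionOfShape J f) :
    MorphismProperty.transfiniteCompositions.{w} W f := by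
  choose K i₁ i₂ i₃ i₄ h using fun j => (MorphismProperty.transfiniteCompositions_iff _ _).1
    (hf.map_mem j (not_isMax j))
  replace h := fun j => (h j).some
  let c : Cocone hf.F := Cocone.mk Y hf.incl
  let : SuccOrder (Σₗ j, K j) := SuccOrder.ofLinearWellFoundedLT _
  refine MorphismProperty.transfiniteCompositionsOfShape_le_transfiniteCompositions _
    (Σₗ j, K j) _ ⟨{
      F := LexComposition.functor h
      isoBot := (h ⊥).isoBot ≪≫ hf.isoBot
      isWellOrderContinuous := LexComposition.isWellOrderContinuous_functor h
      incl := (LexComposition.cocone h c).ι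
      isColimit := LexComposition.isColimitCocone h hf.isColimit
      fac := ?_
      map_mem j hj := LexComposition.map_mem h hW (Order.covBy_succ_of_not_isMax hj) }⟩
  have := LexComposition.into_toPt h c (⊥ : K ⊥)
  rw [LexComposition.into_bot] at this
  exact (Category.assoc _ _ _).trans ((congrArg (hf.isoBot.inv ≫ ·) this).trans hf.fac)

end Lexicographic

/-! ### Attaching cells one at a time -/

section CellAttachment

variable {C : Type u} [Category.{v} C] [HasCoproducts.{w} C] [HasPushouts C] {ι : Type w}
  {A B : ι → C} (n : ∀ i, A i ⟶ B i) {X : C} (u : ∀ i, A i ⟶ X)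

/-- The object obtained from `X` by attaching the cells `n i` along `u i`, for all `i` in `S`. -/
noncomputable def attachment (S : Set ι) : C :=
  pushout (Sigma.desc (fun i : S => u i)) (Limits.Sigma.map (fun i : S => n i))

namespace attachment

/-- The inclusion of the object to which the cells are attached. -/
noncomputable def inl (S : Set ι) : X ⟶ attachment n u S := pushout.inl _ _

/-- The inclusion of a cell. -/
noncomputable def cell {S : Set ι} (i : ι) (hi : i ∈ S) : B i ⟶ attachment n u S :=
  Sigma.ι (fun i : S => B i) ⟨i, hi⟩ ≫ pushout.inr _ _

variable {S S' : Set ι}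

lemma w (i : ι) (hi : i ∈ S) : u i ≫ inl n u S = n i ≫ cell n u i hi := by
  have := Sigma.ι (fun i : S => A i) ⟨i, hi⟩ ≫=
    (IsPushout.of_hasPushout (Sigma.desc (fun i : S => u i))
      (Limits.Sigma.map (fun i : S => n i))).w
  rwa [Sigma.ι_desc_assoc, Sigma.ι_map_assoc] at this

variable {n u} in
lemma hom_ext {T : C} {x y : attachment n u S ⟶ T} (h₀ : inl n u S ≫ x = inl n u S ≫ y)
    (h : ∀ i hi, cell n u i hi ≫ x = cell n u i hi ≫ y) : x = y := by
  refine (IsPushout.of_hasPushout _ _).hom_ext h₀ (Sigma.hom_ext _ _ (fun i => ?_))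
  exact (Category.assoc _ _ _).symm.trans ((h i.1 i.2).trans (Category.assoc _ _ _))

section

variable {n u} {T : C} (x : X ⟶ T) (y : ∀ i ∈ S, B i ⟶ T)
    (h : ∀ i hi, u i ≫ x = n i ≫ y i hi)

/-- A morphism from an attachment is given by compatible morphisms on `X` and on the cells. -/
noncomputable def desc : attachment n u S ⟶ T :=
  (IsPushout.of_hasPushout _ _).desc x (Sigma.desc (fun i : S => y i i.2))
    (Sigma.hom_ext _ _ (fun i => by
      rw [Sigma.ι_desc_assoc, Sigma.ι_map_assoc, Sigma.ι_desc, h]))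

lemma inl_desc : inl n u S ≫ desc x y h = x :=
  (IsPushout.of_hasPushout _ _).inl_desc _ _ _

lemma cell_desc (i : ι) (hi : i ∈ S) : cell n u i hi ≫ desc x y h = y i hi := by
  refine (Category.assoc _ _ _).trans ((congrArg (Sigma.ι (fun i : S => B i) ⟨i, hi⟩ ≫ ·)
    ((IsPushout.of_hasPushout _ _).inr_desc _ _ _)).trans ?_)
  rw [Sigma.ι_desc]

end

/-- The inclusion of an attachment into one with more cells. -/
noncomputable def map (h : S ⊆ S') : attachment n u S ⟶ attachment n u S' :=
  desc (inl n u S') (fun i hi => cell n u i (h hi)) (fun i hi => w n u i (h hi))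

lemma inl_map (h : S ⊆ S') : inl n u S ≫ map n u h = inl n u S' :=
  inl_desc _ _ _

lemma cell_map (h : S ⊆ S') (i : ι) (hi : i ∈ S) :
    cell n u i hi ≫ map n u h = cell n u i (h hi) :=
  cell_desc _ _ _ _ _

/-- The attachments of increasing families of cells. -/
noncomputable def functor {K : Type*} [Preorder K] {S : K → Set ι} (hS : Monotone S) : K ⥤ C where
  obj k := attachment n u (S k)
  map f := map n u (hS (leOfHom f))
  map_id k := hom_ext (by rw [inl_map, Category.comp_id])
    (fun i hi => by rw [cell_map, Category.comp_id])
  map_comp f g := hom_ext (by simp only [inl_map, reassoc_of% @inl_map])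
    (fun i hi => by simp only [cell_map, reassoc_of% @cell_map])

/-- Attaching one more cell is a pushout of the corresponding morphism `n i`. -/
lemma isPushout (h : S ⊆ S') (i : ι) (hi : i ∉ S) (hi' : i ∈ S')
    (hS : ∀ j ∈ S', j ∈ S ∨ j = i) :
    IsPushout (u i ≫ inl n u S) (n i) (map n u h) (cell n u i hi') := by
  have hex (s : PushoutCocone (u i ≫ inl n u S) (n i)) : ∃ t : attachment n u S' ⟶ s.pt,
      map n u h ≫ t = s.inl ∧ cell n u i hi' ≫ t = s.inr := by
    -- The cells of `S'` are mapped according to whether they belong to `S` or are the new one.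
    have hy : ∀ j, j ∈ S' → ∃ y : B j ⟶ s.pt, (u j ≫ inl n u S ≫ s.inl = n j ≫ y) ∧
        (∀ hj : j ∈ S, y = cell n u j hj ≫ s.inl) ∧
        ∀ hj : i = j, eqToHom (congrArg B hj) ≫ y = s.inr := by
      intro j hj
      obtain hj | rfl := hS j hj
      · exact ⟨cell n u j hj ≫ s.inl, by rw [← Category.assoc, w n u j hj, Category.assoc],
          fun _ => rfl, fun e => (hi (e ▸ hj)).elim⟩
      · exact ⟨s.inr, by rw [← Category.assoc, s.condition], fun hj => (hi hj).elim,
          fun _ => Category.id_comp _⟩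
    choose y hy₁ hy₂ hy₃ using hy
    refine ⟨desc (inl n u S ≫ s.inl) y hy₁, hom_ext ?_ (fun j hj => ?_), ?_⟩
    · rw [reassoc_of% @inl_map, inl_desc]
    · rw [reassoc_of% @cell_map, cell_desc, hy₂]
    · rw [cell_desc, ← hy₃ i hi' rfl]
      exact (Category.id_comp _).symm
  choose t ht ht' using hex
  refine ⟨⟨by rw [Category.assoc, inl_map, w n u i hi']⟩,
    ⟨PushoutCocone.IsColimit.mk _ t ht ht' (fun s m hm hm' => hom_ext ?_ (fun j hj => ?_))⟩⟩
  · rw [← inl_map n u h, Category.assoc, Category.assoc, hm, ht]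
  · obtain hj | rfl := hS j hj
    · rw [← cell_map n u h j hj, Category.assoc, Category.assoc, hm, ht]
    · rw [hm', ht']

/-- Attaching no cells changes nothing. -/
@[simps]
noncomputable def isoOfEmpty (hS : ∀ i, i ∉ S) : attachment n u S ≅ X where
  hom := desc (𝟙 X) (fun i hi => (hS i hi).elim) (fun i hi => (hS i hi).elim)
  inv := inl n u S
  hom_inv_id := hom_ext (by rw [reassoc_of% @inl_desc, Category.comp_id, Category.id_comp])
    (fun i hi => (hS i hi).elim)
  inv_hom_id := inl_desc _ _ _

/-- Attachments are continuous in the set of cells: a colimit below `m` is the attachment of the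
union of the sets of cells. The hypothesis `hdir` holds in a linear order. -/
lemma nonempty_isColimit {K : Type*} [PartialOrder K] {S : K → Set ι} (hS : Monotone S) {m : K}
    (hne : ∃ k, k < m) (hm : ∀ i ∈ S m, ∃ k < m, i ∈ S k)
    (hdir : ∀ k l, k < m → l < m → k ≤ l ∨ l ≤ k) :
    Nonempty (IsColimit ((Set.principalSegIio m).cocone (functor n u hS))) := by
  refine ⟨IsColimit.ofExistsUnique (fun s => ?_)⟩
  obtain ⟨k₀, hk₀⟩ := hne
  choose! k hk hk' using hm
  let t (a : K) (ha : a < m) : attachment n u (S a) ⟶ s.pt := s.ι.app ⟨a, ha⟩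
  have ht {a b : K} (hab : a ≤ b) (hb : b < m) :
      map n u (hS hab) ≫ t b hb = t a (hab.trans_lt hb) :=
    s.w (homOfLE hab : (⟨a, hab.trans_lt hb⟩ : Set.Iio m) ⟶ ⟨b, hb⟩)
  have hinl {a b : K} (ha : a < m) (hb : b < m) : inl n u _ ≫ t a ha = inl n u _ ≫ t b hb := by
    obtain hab | hab := hdir a b ha hb
    · rw [← ht hab hb, reassoc_of% @inl_map]
    · rw [← ht hab ha, reassoc_of% @inl_map]
  have hcell {a b : K} (ha : a < m) (hb : b < m) (i : ι) (hia : i ∈ S a) (hib : i ∈ S b) :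
      cell n u i hia ≫ t a ha = cell n u i hib ≫ t b hb := by
    obtain hab | hab := hdir a b ha hb
    · rw [← ht hab hb, reassoc_of% @cell_map]
    · rw [← ht hab ha, reassoc_of% @cell_map]
  refine ⟨desc (S := S m) (inl n u _ ≫ t k₀ hk₀)
    (fun i hi => cell n u i (hk' i hi) ≫ t _ (hk i hi)) (fun i hi => ?_), ?_,
    fun (d : attachment n u (S m) ⟶ s.pt) hd => ?_⟩
  · rw [hinl hk₀ (hk i hi), ← Category.assoc, w n u i (hk' i hi), Category.assoc]
  · rintro ⟨a, ha⟩
    change map n u (hS ha.le) ≫ desc _ _ _ = t a ha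
    refine hom_ext ?_ (fun i hi => ?_)
    · rw [reassoc_of% @inl_map, inl_desc, hinl hk₀ ha]
    · rw [reassoc_of% @cell_map, cell_desc, hcell _ ha i _ hi]
  · have hd' (a : K) (ha : a < m) : map n u (hS ha.le) ≫ d = t a ha := hd ⟨a, ha⟩
    refine hom_ext ?_ (fun i hi => ?_)
    · rw [inl_desc, ← hd', reassoc_of% @inl_map]
    · rw [cell_desc, ← hd', reassoc_of% @cell_map]

/-- Cells may be attached one after the other. -/
theorem transfiniteCompositions_inl {N : MorphismProperty C} (hn : ∀ i, N (n i)) :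
    MorphismProperty.transfiniteCompositions.{w} N.pushouts (inl n u Set.univ) := by
  classical
  let : LinearOrder ι := linearOrderOfSTO WellOrderingRel
  have : WellFoundedLT ι := ⟨WellOrderingRel.isWellOrder.wf⟩
  -- In position `k` of `K = WithTop ι` the cells before `k` have been attached, so that
  -- all of them have been attached in position `⊤`.
  let K := WithTop ι
  let : OrderBot K := WellFoundedLT.toOrderBot K
  let : SuccOrder K := SuccOrder.ofLinearWellFoundedLT K
  let S (k : K) : Set ι := {i | (i : K) < k}
  have hS : Monotone S := fun _ _ hk _ hi => lt_of_lt_of_le hi hk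
  have h : MorphismProperty.transfiniteCompositions.{w} N.pushouts (inl n u (S ⊤)) := by
    refine MorphismProperty.transfiniteCompositionsOfShape_le_transfiniteCompositions _ K _ ⟨{
      F := functor n u hS
      isoBot := isoOfEmpty n u (fun i => (not_lt_bot : ¬ (i : K) < ⊥))
      isWellOrderContinuous := ⟨fun m hm => ?_⟩
      incl := _
      isColimit := colimitOfDiagramTerminal isTerminalTop _
      fac := inl_map n u _
      map_mem k hk := ?_ }⟩
    · exact nonempty_isColimit n u hS ⟨⊥, hm.bot_lt⟩
        (fun i (hi : (i : K) < m) => ⟨Order.succ (i : K), hm.succ_lt hi,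
          show (i : K) < _ from Order.lt_succ_of_not_isMax hi.not_isMax⟩)
        (fun k l _ _ => le_total k l)
    · obtain ⟨i, rfl⟩ := WithTop.ne_top_iff_exists.1 (fun h : k = ⊤ => hk (h ▸ isMax_top))
      refine MorphismProperty.pushouts_mk _ (isPushout n u _ i (lt_irrefl (i : K))
        (Order.lt_succ_of_not_isMax hk) (fun j hj => ?_)) (hn i)
      obtain hj | hj := (Order.lt_succ_iff_of_not_isMax hk).1 hj |>.lt_or_eq
      · exact Or.inl hj
      · exact Or.inr (WithTop.coe_injective hj)
  have hST : S ⊤ = Set.univ := Set.eq_univ_of_forall (fun i => WithTop.coe_lt_top i)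
  rwa [hST] at h

end attachment

/-- A pushout of a coproduct of members of `N` is a transfinite composition of pushouts of
members of `N`. -/
theorem pushouts_coproducts_le_transfiniteCompositions (N : MorphismProperty C) :
    (MorphismProperty.coproducts.{w} N).pushouts ≤
      MorphismProperty.transfiniteCompositions.{w} N.pushouts := by
  rintro Y Z f ⟨P, Q, m, a, b, hm, sq⟩
  rw [MorphismProperty.coproducts_iff] at hm
  obtain ⟨ι, ⟨F₁, F₂, c₁, c₂, h₁, h₂, φ, hφ⟩⟩ := hm
  let n (i : ι) := φ.app ⟨i⟩
  let a' (i : ι) : F₁.obj ⟨i⟩ ⟶ c₁.pt := c₁.ι.app ⟨i⟩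
  let b' (i : ι) : F₂.obj ⟨i⟩ ⟶ c₂.pt := c₂.ι.app ⟨i⟩
  -- `m` is made opaque here, as it is used through its restrictions to the summands only.
  obtain ⟨m, hm⟩ : ∃ m, m = h₁.desc (Cocone.mk _ (φ ≫ c₂.ι)) := ⟨_, rfl⟩
  rw [← hm] at sq
  have hm' (i) : a' i ≫ m = n i ≫ b' i := by
    rw [hm]
    exact h₁.fac _ _
  have hf (i) : (a' i ≫ a) ≫ f = n i ≫ b' i ≫ b := by
    rw [Category.assoc, sq.w, ← Category.assoc, hm', Category.assoc]
  let x := attachment.inl n (fun i => a' i ≫ a) Set.univ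
  let y (i : ι) := attachment.cell n (fun i => a' i ≫ a) i (Set.mem_univ i)
  have hxy (i) : (a' i ≫ a) ≫ x = n i ≫ y i :=
    attachment.w n (fun i => a' i ≫ a) i (Set.mem_univ i)
  obtain ⟨d, hd⟩ : ∃ d : c₂.pt ⟶ attachment n (fun i => a' i ≫ a) Set.univ, ∀ i, b' i ≫ d = y i :=
    ⟨h₂.desc { pt := _, ι := Discrete.natTrans (fun ⟨i⟩ => y i) }, fun i => h₂.fac _ _⟩
  have hxd : a ≫ x = m ≫ d := h₁.hom_ext (fun ⟨i⟩ => by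
    change a' i ≫ a ≫ x = a' i ≫ m ≫ d
    rw [← Category.assoc, hxy, reassoc_of% (hm' i), hd])
  let e : attachment n (fun i => a' i ≫ a) Set.univ ≅ Z :=
    { hom := attachment.desc f (fun i _ => b' i ≫ b) (fun i _ => hf i)
      inv := sq.desc x d hxd
      hom_inv_id := attachment.hom_ext
        (by rw [reassoc_of% @attachment.inl_desc, sq.inl_desc, Category.comp_id])
        (fun i hi => by
          rw [reassoc_of% @attachment.cell_desc, Category.assoc, sq.inr_desc, hd, Category.comp_id])
      inv_hom_id := by
        refine sq.hom_ext ?_ (h₂.hom_ext (fun ⟨i⟩ => ?_))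
        · rw [sq.inl_desc_assoc, Category.comp_id, attachment.inl_desc]
        · change b' i ≫ b ≫ _ = b' i ≫ b ≫ _
          rw [sq.inr_desc_assoc, reassoc_of% (hd i), attachment.cell_desc, Category.comp_id] }
  have hx := attachment.transfiniteCompositions_inl n (fun i => a' i ≫ a) (fun i => hφ ⟨i⟩)
  rw [MorphismProperty.transfiniteCompositions_iff] at hx ⊢
  obtain ⟨K, _, _, _, _, hx⟩ := hx
  have hxe : x ≫ e.hom = f := attachment.inl_desc f (fun i _ => b' i ≫ b) (fun i _ => hf i)
  have e' : Arrow.mk x ≅ Arrow.mk f := Arrow.isoMk (Iso.refl _) e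
    ((Category.id_comp _).trans hxe.symm)
  exact ⟨K, _, _, _, _, (MorphismProperty.arrow_mk_iso_iff _ e').1 hx⟩

end CellAttachment

/-! ### The small object argument -/

section SmallObjectArgument

variable {C : Type u} [Category.{v} C] {κ : Cardinal.{w}} [Fact κ.IsRegular]
  [IsCardinalLocallyPresentable C κ] {N : MorphismProperty C}

lemma isCardinalForSmallObjectArgument [OrderBot κ.ord.ToType] [MorphismProperty.IsSmall.{w} N]
    (hN : N ≤ betweenPresentables C κ) : N.IsCardinalForSmallObjectArgument κ where
  preservesColimit {A B X Y} i hi f hf := by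
    have := (hN i hi).1
    have := preservesColimitsOfShape_of_isCardinalPresentable A κ κ.ord.ToType
    infer_instance

/-- The small object argument yields a transfinite composition of pushouts of coproducts of members
of `N`. Attaching the cells one at a time refines it to a transfinite composition of pushouts of
members of `N`. The isomorphisms are needed as steps between consecutive families of cells. -/
lemma exists_transfiniteComposition_rlp_factorization [MorphismProperty.IsSmall.{w} N]
    (hN : N ≤ betweenPresentables C κ) (hN' : MorphismProperty.isomorphisms C ≤ N.pushouts)
    {X Y : C} (f : X ⟶ Y) :
    ∃ (Z : C) (i : X ⟶ Z) (p : Z ⟶ Y), i ≫ p = f ∧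
      MorphismProperty.transfiniteCompositions.{w} N.pushouts i ∧ N.rlp p := by
  have := Cardinal.noMaxOrder (Cardinal.IsRegular.aleph0_le (Fact.out : κ.IsRegular))
  have : Nonempty κ.ord.ToType := IsCardinalFiltered.nonempty _ κ
  let : OrderBot κ.ord.ToType := WellFoundedLT.toOrderBot _
  have := isCardinalForSmallObjectArgument hN
  refine ⟨_, SmallObject.ιObj N κ f, SmallObject.πObj N κ f, SmallObject.ιObj_πObj N κ f, ?_,
    SmallObject.rlp_πObj N κ f⟩
  obtain ⟨h⟩ := SmallObject.transfiniteCompositionsOfShape_ιObj N κ f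
  exact transfiniteCompositions_of_transfiniteCompositionOfShape hN'
    (h.ofLE (pushouts_coproducts_le_transfiniteCompositions N))

variable [MorphismProperty.IsSmall.{w} N] (hN : N ≤ betweenPresentables C κ)
  (hN' : MorphismProperty.isomorphisms C ≤ N.pushouts)

include hN hN'

/-- The retract argument. -/
lemma cofibrations_eq_llp_rlp : cofibrations.{w} N = N.rlp.llp := by
  refine le_antisymm ?_ (fun A B f hf => ?_)
  · rintro A B f ⟨B', g, hg, ⟨h⟩⟩
    have hg' : N.rlp.llp g := MorphismProperty.transfiniteCompositions_le_iff.2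
      (MorphismProperty.pushouts_le_iff.2 N.le_llp_rlp) _ hg
    exact MorphismProperty.of_retract (P := N.rlp.llp)
      { i := Arrow.homMk (𝟙 A) h.i.right ((Category.id_comp _).trans (Under.w h.i).symm)
        r := Arrow.homMk (𝟙 A) h.r.right ((Category.id_comp _).trans (Under.w h.r).symm)
        retract := Arrow.hom_ext _ _ (Category.id_comp _) (congrArg (fun x => x.right) h.retract) }
      hg'
  · obtain ⟨Z, i, p, hip, hi, hp⟩ := exists_transfiniteComposition_rlp_factorization hN hN' f
    have := hf p hp
    have sq : CommSq i f p (𝟙 B) := ⟨by simp [hip]⟩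
    exact ⟨Z, i, hi, ⟨{
      i := Under.homMk sq.lift sq.fac_left
      r := Under.homMk p hip
      retract := by
        ext
        exact sq.fac_right }⟩⟩

theorem isWeakFactorizationSystem_cofibrations :
    MorphismProperty.IsWeakFactorizationSystem (cofibrations.{w} N) N.rlp ∧
      MorphismProperty.HasFunctorialFactorization (cofibrations.{w} N) N.rlp := by
  have : Nonempty κ.ord.ToType := IsCardinalFiltered.nonempty _ κ
  let : OrderBot κ.ord.ToType := WellFoundedLT.toOrderBot _
  have := isCardinalForSmallObjectArgument hN
  rw [cofibrations_eq_llp_rlp hN hN']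
  have := SmallObject.hasFunctorialFactorization N κ
  refine ⟨⟨?_, rfl, inferInstance⟩, this⟩
  exact N.rlp_llp_rlp

end SmallObjectArgument

/-! ### Injectivity and orthogonality of objects and of morphisms -/

section ObjectsAndMorphisms

variable {C : Type u} [Category.{v} C]

lemma le_injectiveMorphisms_injectiveObjects (M : MorphismProperty C) :
    M ≤ injectiveMorphisms (injectiveObjects M) :=
  fun _ _ m hm _ hK => hK m hm

lemma le_orthogonalMorphisms_orthogonalObjects (M : MorphismProperty C) :
    M ≤ orthogonalMorphisms (orthogonalObjects M) :=
  fun _ _ m hm _ hK => hK m hm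

lemma injectiveObjects_anti {N N' : MorphismProperty C} (h : N ≤ N') :
    injectiveObjects N' ≤ injectiveObjects N :=
  fun _ hK _ _ n hn => hK n (h n hn)

lemma orthogonalObjects_anti {N N' : MorphismProperty C} (h : N ≤ N') :
    orthogonalObjects N' ≤ orthogonalObjects N :=
  fun _ hK _ _ n hn => hK n (h n hn)

lemma injectiveObjects_le_pushouts (N : MorphismProperty C) :
    injectiveObjects N ≤ injectiveObjects N.pushouts := by
  rintro K hK A B m ⟨A₀, B₀, n, p, q, hn, sq⟩ x
  obtain ⟨y, hy⟩ := hK n hn (p ≫ x)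
  exact ⟨sq.desc x y hy.symm, sq.inl_desc _ _ _⟩

lemma orthogonalObjects_le_pushouts (N : MorphismProperty C) :
    orthogonalObjects N ≤ orthogonalObjects N.pushouts := by
  rintro K hK A B m ⟨A₀, B₀, n, p, q, hn, sq⟩ x
  obtain ⟨y, hy, hy'⟩ := hK n hn (p ≫ x)
  refine ⟨sq.desc x y hy.symm, sq.inl_desc _ _ _, fun z hz => sq.hom_ext ?_ ?_⟩
  · rw [sq.inl_desc, hz]
  · rw [sq.inr_desc]
    refine hy' _ ?_
    change n ≫ q ≫ z = p ≫ x
    rw [← show m ≫ z = x from hz, sq.w_assoc]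

lemma rlp_from_iff {T : C} (hT : IsTerminal T) (N : MorphismProperty C) (X : C) :
    N.rlp (hT.from X) ↔ injectiveObjects N X := by
  refine ⟨fun h A B n hn x => ?_, fun h A B n hn => ⟨fun {f g} sq => ?_⟩⟩
  · have := h n hn
    have sq : CommSq x n (hT.from X) (hT.from B) := ⟨hT.hom_ext _ _⟩
    exact ⟨sq.lift, sq.fac_left⟩
  · obtain ⟨y, hy⟩ := h n hn f
    exact ⟨⟨⟨y, hy, hT.hom_ext _ _⟩⟩⟩

lemma rightOrthogonal_from_iff {T : C} (hT : IsTerminal T) (N : MorphismProperty C) (X : C) :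
    rightOrthogonal N (hT.from X) ↔ orthogonalObjects N X := by
  refine ⟨fun h A B n hn x => ?_, fun h A B n hn f g _ => ?_⟩
  · obtain ⟨y, hy, hy'⟩ := h n hn x (hT.from B) (hT.hom_ext _ _)
    exact ⟨y, hy.1, fun z hz => hy' z ⟨hz, hT.hom_ext _ _⟩⟩
  · obtain ⟨y, hy, hy'⟩ := h n hn f
    exact ⟨y, ⟨hy, hT.hom_ext _ _⟩, fun z hz => hy' z hz.1⟩

lemma isDeterminedBy_rlp_iff [HasTerminal C] (P : ObjectProperty C) (N : MorphismProperty C) :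
    IsDeterminedBy P N.rlp ↔ P = injectiveObjects N := by
  refine ⟨fun ⟨T, hT, h⟩ => ?_, ?_⟩
  · ext X
    rw [h, rlp_from_iff]
  · rintro rfl
    exact ⟨_, terminalIsTerminal, fun X => (rlp_from_iff _ N X).symm⟩

lemma isDeterminedBy_rightOrthogonal_iff [HasTerminal C] (P : ObjectProperty C)
    (N : MorphismProperty C) :
    IsDeterminedBy P (rightOrthogonal N) ↔ P = orthogonalObjects N := by
  refine ⟨fun ⟨T, hT, h⟩ => ?_, ?_⟩
  · ext X
    rw [h, rightOrthogonal_from_iff]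
  · rintro rfl
    exact ⟨_, terminalIsTerminal, fun X => (rightOrthogonal_from_iff _ N X).symm⟩

/-- Every isomorphism `A ⟶ B` is a pushout of the identity along `⊥_ C ⟶ A`. -/
lemma isomorphisms_le_pushouts_of_id {N : MorphismProperty C} [HasInitial C]
    (h : N.pushouts (𝟙 (⊥_ C))) : MorphismProperty.isomorphisms C ≤ N.pushouts := by
  intro A B f (hf : IsIso f)
  have : IsPushout (initial.to A) (𝟙 (⊥_ C)) f (initial.to B) :=
    IsPushout.of_vert_isIso ⟨Subsingleton.elim _ _⟩
  exact MorphismProperty.of_isPushout this h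

end ObjectsAndMorphisms

/-! ### Generating sets of factorization systems -/

section FactorizationSystem

variable {C : Type u} [Category.{v} C] {κ : Cardinal.{w}} [Fact κ.IsRegular]

lemma rightOrthogonal_le_pushouts (N : MorphismProperty C) :
    rightOrthogonal N ≤ rightOrthogonal N.pushouts := by
  rintro X Y i hi A B m ⟨A₀, B₀, n, p, q, hn, sq⟩
  exact leftOrthogonal_of_isPushout sq (le_leftOrthogonal_rightOrthogonal N _ hn) i hi

lemma filteredColimits_comp_iso {N : MorphismProperty C} {A B B' : C} {f : A ⟶ B}
    (hf : filteredColimits κ N f) (e : B ≅ B') : filteredColimits κ N (f ≫ e.hom) := by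
  obtain ⟨J, _, _, D, c, hc, e', hD, h⟩ := hf
  exact ⟨J, _, ‹_›, D, c, hc, e' ≪≫ e, hD, fun j => by
    rw [← h j]
    exact (congrArg ((D.obj j).hom ≫ ·) (Category.assoc _ _ _).symm).trans
      (Category.assoc _ _ _).symm⟩

/-- A morphism orthogonal to itself is invertible. -/
lemma isIso_of_uniqueLifting_self {X Y : C} {f : X ⟶ Y} (hf : UniqueLifting f f) : IsIso f := by
  obtain ⟨d, ⟨h₁, h₂⟩, -⟩ := hf (𝟙 X) (𝟙 Y) (by simp)
  exact ⟨d, h₁, h₂⟩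

/-- The generating set `N` is not a set of representatives of `N₀`, but of all morphisms between
`κ`-presentable objects which are left orthogonal to `rightOrthogonal N₀`: the factorization needs a
class closed under codiagonals, coproducts and composition. -/
theorem exists_isFactorizationSystem [IsCardinalLocallyPresentable C κ] {N₀ : MorphismProperty C}
    (hN₀ : N₀ ≤ betweenPresentables C κ) :
    ∃ N : MorphismProperty C, MorphismProperty.IsSmall.{w} N ∧ N ≤ betweenPresentables C κ ∧
      N ≤ leftOrthogonal (rightOrthogonal N₀) ∧ N₀ ≤ N.pushouts ∧
      IsFactorizationSystem (filteredColimits κ N.pushouts) (rightOrthogonal N) := by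
  let R := rightOrthogonal N₀
  let W := presentableLeftOrthogonal κ R
  obtain ⟨N, hN, hNW, hWN⟩ := exists_isSmall_le_pushouts.{w} (κ := κ) (W := W) inf_le_right
  have hN₀W : N₀ ≤ W := le_inf (le_leftOrthogonal_rightOrthogonal N₀) hN₀
  have hpo : N.pushouts = W.pushouts :=
    le_antisymm (MorphismProperty.pushouts_monotone hNW) (MorphismProperty.pushouts_le_iff.2 hWN)
  have hNR : rightOrthogonal N = R := by
    refine le_antisymm ?_ ?_
    · exact (rightOrthogonal_le_pushouts N).trans (rightOrthogonal_anti (hN₀W.trans hWN))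
    · exact (le_rightOrthogonal_leftOrthogonal R).trans
        (rightOrthogonal_anti (hNW.trans inf_le_left))
  have hWR : rightOrthogonal W ≤ R := rightOrthogonal_anti hN₀W
  have hE : filteredColimits κ W.pushouts ≤ leftOrthogonal R :=
    filteredColimits_le_leftOrthogonal pushouts_presentableLeftOrthogonal_le
  refine ⟨N, hN, hNW.trans inf_le_right, hNW.trans inf_le_left, hN₀W.trans hWN, ?_⟩
  rw [hpo, hNR]
  have hE' : leftOrthogonal R = filteredColimits κ W.pushouts := by
    refine le_antisymm (fun X Y f hf => ?_) hE
    obtain ⟨Z, i, p, rfl, hi, hp⟩ := exists_factorization (κ := κ) R f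
    have := isIso_of_uniqueLifting_self (leftOrthogonal_of_comp (hE _ hi) hf p (hWR _ hp))
    exact filteredColimits_comp_iso hi (asIso p)
  refine ⟨hE', ?_, ⟨fun f => ?_⟩⟩
  · rw [← hE']
    exact le_antisymm (rightOrthogonal_anti (le_leftOrthogonal_rightOrthogonal N₀))
      (le_rightOrthogonal_leftOrthogonal R)
  · obtain ⟨Z, i, p, h, hi, hp⟩ := exists_factorization (κ := κ) R f
    exact ⟨{ Z := Z, i := i, p := p, fac := h, hi := hi, hp := hWR _ hp }⟩

lemma orthogonalObjects_le_leftOrthogonal_rightOrthogonal [HasTerminal C]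
    (N : MorphismProperty C) :
    orthogonalObjects N ≤ orthogonalObjects (leftOrthogonal (rightOrthogonal N)) :=
  fun K hK => (rightOrthogonal_from_iff terminalIsTerminal _ K).1
    (le_rightOrthogonal_leftOrthogonal _ _
      ((rightOrthogonal_from_iff terminalIsTerminal N K).2 hK))

/-- A small set of morphisms between `κ`-presentable objects with the same injective objects as a
given class, and with enough members for the small object argument to yield cofibrations. -/
theorem exists_isSmall_injectiveObjects_eq [IsCardinalLocallyPresentable C κ]
    {N₀ : MorphismProperty C} (hN₀ : N₀ ≤ betweenPresentables C κ) :
    ∃ N : MorphismProperty C, MorphismProperty.IsSmall.{w} N ∧ N ≤ betweenPresentables C κ ∧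
      injectiveObjects N = injectiveObjects N₀ ∧
      MorphismProperty.isomorphisms C ≤ N.pushouts := by
  obtain ⟨N, hN, hNW, hWN⟩ := exists_isSmall_le_pushouts.{w} (κ := κ)
    (W := injectiveMorphisms (injectiveObjects N₀) ⊓ betweenPresentables C κ) inf_le_right
  have hN₀N : N₀ ≤ N.pushouts :=
    (le_inf (le_injectiveMorphisms_injectiveObjects N₀) hN₀).trans hWN
  refine ⟨N, hN, hNW.trans inf_le_right, le_antisymm ?_ ?_, ?_⟩
  · exact (injectiveObjects_le_pushouts N).trans (injectiveObjects_anti hN₀N)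
  · exact fun K hK A B n hn => (hNW n hn).1 K hK
  -- The class represented by `N` contains the identity of the initial object.
  · refine isomorphisms_le_pushouts_of_id (hWN _ ⟨fun K _ x => ⟨x, Category.id_comp x⟩, ?_⟩)
    exact ⟨isCardinalPresentable_initial, isCardinalPresentable_initial⟩

end FactorizationSystem

end PresentableMorphisms

open PresentableMorphisms
theorem proposition1p6 {C : Type u} [Category.{v} C] (κ : Cardinal.{w}) [Fact κ.IsRegular]
    [IsCardinalLocallyPresentable C κ] (M : MorphismProperty C)
    (hM : M ≤ presentableMorphisms C κ) :
    List.TFAE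
      [ IsInjectivityClass κ (injectiveObjects M),
        ClosedUnderFilteredColimits κ (injectiveObjects M),
        M ≤ (injectiveMorphisms (injectiveObjects M) ⊓ betweenPresentables C κ).pushouts,
        ∃ N : MorphismProperty C, MorphismProperty.IsSmall.{w} N ∧ N ≤ betweenPresentables C κ ∧
          MorphismProperty.IsWeakFactorizationSystem (cofibrations.{w} N) N.rlp ∧
          MorphismProperty.HasFunctorialFactorization (cofibrations.{w} N) N.rlp ∧
          IsDeterminedBy (injectiveObjects M) N.rlp ] ∧
    List.TFAE
      [ IsOrthogonalityClass κ (orthogonalObjects M),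
        ClosedUnderFilteredColimits κ (orthogonalObjects M),
        M ≤ (orthogonalMorphisms (orthogonalObjects M) ⊓ betweenPresentables C κ).pushouts,
        ∃ N : MorphismProperty C, MorphismProperty.IsSmall.{w} N ∧ N ≤ betweenPresentables C κ ∧
          IsFactorizationSystem (filteredColimits κ N.pushouts) (rightOrthogonal N) ∧
          IsDeterminedBy (orthogonalObjects M) (rightOrthogonal N) ] := by
  have := hasLimitsOfSize_of_isCardinalLocallyPresentable (C := C) κ
  have : HasFiniteLimits C := hasFiniteLimits_of_hasLimitsOfSize.{w, w} C
  have hM' := hM.trans presentableMorphisms_le_pushouts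
  constructor
  · tfae_have 1 → 2 := by
      rintro ⟨N, hN, h⟩
      exact h ▸ closedUnderFilteredColimits_injectiveObjects hN
    tfae_have 2 → 3 := fun h A B m hm =>
      pushouts_injectiveMorphisms h (injectiveObjects_pi M) (hM' m hm)
        (le_injectiveMorphisms_injectiveObjects M m hm)
    tfae_have 3 → 1 := fun h => ⟨_, inf_le_right, le_antisymm (fun K hK A B n hn => hn.1 K hK)
      ((injectiveObjects_le_pushouts _).trans (injectiveObjects_anti h))⟩
    tfae_have 1 → 4 := by
      rintro ⟨N₀, hN₀, h⟩
      obtain ⟨N, _, hN, hNN₀, hiso⟩ := exists_isSmall_injectiveObjects_eq hN₀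
      obtain ⟨h₁, h₂⟩ := isWeakFactorizationSystem_cofibrations hN hiso
      exact ⟨N, inferInstance, hN, h₁, h₂, (isDeterminedBy_rlp_iff _ _).2 (h.trans hNN₀.symm)⟩
    tfae_have 4 → 1 := fun ⟨N, _, hN, _, _, h⟩ => ⟨N, hN, (isDeterminedBy_rlp_iff _ _).1 h⟩
    tfae_finish
  · tfae_have 1 → 2 := by
      rintro ⟨N, hN, h⟩
      exact h ▸ closedUnderFilteredColimits_orthogonalObjects hN
    tfae_have 2 → 3 := fun h A B m hm =>
      pushouts_orthogonalMorphisms h (orthogonalObjects_pi M) (hM' m hm)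
        (le_orthogonalMorphisms_orthogonalObjects M m hm)
    tfae_have 3 → 1 := fun h => ⟨_, inf_le_right, le_antisymm (fun K hK A B n hn => hn.1 K hK)
      ((orthogonalObjects_le_pushouts _).trans (orthogonalObjects_anti h))⟩
    tfae_have 1 → 4 := by
      rintro ⟨N₀, hN₀, h⟩
      obtain ⟨N, hN, hNκ, hNN₀, hN₀N, hF⟩ := exists_isFactorizationSystem hN₀
      refine ⟨N, hN, hNκ, hF, (isDeterminedBy_rightOrthogonal_iff _ _).2 (h.trans ?_)⟩
      exact le_antisymm ((orthogonalObjects_le_leftOrthogonal_rightOrthogonal N₀).trans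
        (orthogonalObjects_anti hNN₀))
        ((orthogonalObjects_le_pushouts N).trans (orthogonalObjects_anti hN₀N))
    tfae_have 4 → 1 := fun ⟨N, _, hN, _, h⟩ =>
      ⟨N, hN, (isDeterminedBy_rightOrthogonal_iff _ _).1 h⟩
    tfae_finish
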